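/- Let $0\le c\le 1$ and let $K\ge 1$ be an integer. For an integrable function $A:[0,1)^2\to[0,1]$ put $$\ell(x)=\int_0^1 A(x,y)\,\mathrm{d}y \quad (0\le x<1),\qquad S(A)=\int_0^1\!\int_0^1 \ell(x)\,\ell(y)\,\min(\ell(x),\ell(y))\,\mathrm{d}x\,\mathrm{d}y .$$ Let $A_1(c),A_2(c):[0,1)^2\to[0,1]$ be the functions with $A_1(c)(x,y)=1$ if $\min(x,y)<1-\sqrt{1-c}$ and $0$ otherwise (the quasi-star shape), and $A_2(c)(x,y)=1$ if $\max(x,y)<\sqrt c$ and $0$ otherwise (the quasi-clique shape). Assume that $A:[0,1)^2\to[0,1]$ satisfies $\int_0^1\int_0^1 A(x,y)\,\mathrm{d}x\,\mathrm{d}y=c$ and $A(x,y)=A(y,x)$ for all $0\le x,y<1$, and that there are numbers $0=q_0<q_1<\dots<q_K=1$ such that $A$ is constant on $[q_{i-1},q_i)\times[q_{j-1},q_j)$ for all $1\le i,j\le K$. Then $$S(A)\le \max\bigl(S(A_1(c)),S(A_2(c))\bigr)=\max\Bigl((1-\sqrt{1-c})^2\bigl((c+1)\sqrt{1-c}+c\bigr),\;c^{5/2}\Bigr).$$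 -/

import Mathlib

open MeasureTheory

/-- The marginal `ℓ(x) = ∫₀¹ A(x,y) dy` of a function `A` on `[0,1)²`.
Functions on `[0,1)²` are given as `ℝ → ℝ → ℝ`; only their values on `[0,1)²` are used. -/
noncomputable def ell (A : ℝ → ℝ → ℝ) (x : ℝ) : ℝ :=
  ∫ y in Set.Ico (0 : ℝ) 1, A x y

/-- `S(A) = ∫₀¹ ∫₀¹ ℓ(x) ℓ(y) min(ℓ(x), ℓ(y)) dx dy`. -/
noncomputable def S (A : ℝ → ℝ → ℝ) : ℝ :=
  ∫ x in Set.Ico (0 : ℝ) 1, ∫ y in Set.Ico (0 : ℝ) 1,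
    ell A x * ell A y * min (ell A x) (ell A y)

/-- The quasi-star shape of density `c`. -/
noncomputable def A₁ (c : ℝ) (x y : ℝ) : ℝ :=
  if min x y < 1 - √(1 - c) then 1 else 0

/-- The quasi-clique shape of density `c`. -/
noncomputable def A₂ (c : ℝ) (x y : ℝ) : ℝ :=
  if max x y < √c then 1 else 0

/-- `A` is constant on each cell `[q_{i-1}, q_i) × [q_{j-1}, q_j)` of the grid on `[0,1)²`
given by some partition `0 = q_0 < q_1 < ⋯ < q_K = 1`. -/
def IsStepOnGrid (K : ℕ) (A : ℝ → ℝ → ℝ) : Prop :=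
  ∃ q : Fin (K + 1) → ℝ, StrictMono q ∧ q 0 = 0 ∧ q (Fin.last K) = 1 ∧
    ∀ i j : Fin K, ∃ a : ℝ,
      ∀ x ∈ Set.Ico (q i.castSucc) (q i.succ), ∀ y ∈ Set.Ico (q j.castSucc) (q j.succ),
        A x y = a

/-! A step function is a symmetric matrix `a` with block widths `w`, and `S` becomes `minSum w v`,
where `v` is the vector of block degrees. Since `min (v i) (v j)` is the length of the set of levels
`t ≥ 0` below both degrees, `S` is also the integral over `t` of the square of `∑ w i * v i` over
the blocks of degree above `t`. This layer-cake form makes `S` explicit once the shape is nested.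

Fix the grid and take a matrix of the given density that maximises `S`. If two blocks have equal
degrees, averaging merges them and induction on the number of blocks applies (`exists_average`).
Otherwise all degrees differ, and small changes keep their order. Along such changes `S` is strictly
convex (`exists_minSum_lt`), so a maximiser has at most one cell with a value strictly between 0 and
1, up to transposition (`fractional_unique_of_max`). Among matrices with the same degrees, one of
least square norm is nested: a block of larger degree has the pointwise larger row
(`monotone_of_min_sq`).

A nested matrix whose cells are 0 or 1 is a threshold shape: one can repeatedly remove a block
adjacent to all remaining blocks or one adjacent to none. The possible fractional cell is resolved
during this peeling by splitting a block, without loss in `S`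
(`exists_isThresholdList_levelSum_le`).

For threshold shapes, density-preserving transfers of width make `S` a cubic that is convex on the
admissible interval. Pushing to an endpoint makes some block vanish (`exists_isolatedPart_le`,
`exists_dominatingPart_le`). What remains are two families, each a curve at fixed density. On both
curves the derivative changes sign at most once, from negative to positive, so the maximum sits at
an endpoint. The endpoints lead to the star or the clique (`cliqueStar_le_starCliqueBound`,
`twoStar_le_starCliqueBound`). -/

/-- The larger of the quasi-star and quasi-clique values at density `c`. -/
noncomputable def starCliqueBound (c : ℝ) : ℝ :=
  max ((1 - √(1 - c)) ^ 2 * ((c + 1) * √(1 - c) + c)) (c ^ (5 / 2 : ℝ))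

/-! ### The two extremal values -/

lemma rpow_five_halves {c : ℝ} (hc : 0 ≤ c) : c ^ (5 / 2 : ℝ) = c ^ 2 * √c := by
  rw [show (5 / 2 : ℝ) = (2 : ℕ) + 1 / 2 by norm_num, Real.rpow_add_of_nonneg hc (by norm_num) (by norm_num),
    Real.rpow_natCast, Real.sqrt_eq_rpow]

lemma clique_le_starCliqueBound {c : ℝ} (hc : 0 ≤ c) : c ^ 2 * √c ≤ starCliqueBound c := by
  rw [← rpow_five_halves hc]
  exact le_max_right _ _

lemma star_le_starCliqueBound {c p : ℝ} (hp : p ≤ 1) (hc : c = 2 * p - p ^ 2) :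
    p * c ^ 2 + (1 - p) * p ^ 2 ≤ starCliqueBound c := by
  have h : √(1 - c) = 1 - p := by
    rw [show 1 - c = (1 - p) ^ 2 by rw [hc]; ring]
    exact Real.sqrt_sq (by linarith)
  refine le_trans (le_of_eq ?_) (le_max_left _ _)
  rw [h, hc]
  ring

/-! ### Shapes with one dominating, one clique and one isolated block -/

/-- The sum `S` of a threshold shape with one dominating block, one clique block and one isolated
block, as a function of the width `v` of the isolated block at fixed `d = 1 - c`. -/
noncomputable def cliqueStarCurve (d v : ℝ) : ℝ :=
  (1 - (d / v + v) / 2) * (1 - d) ^ 2 + v * (1 - (d / v + v) / 2) ^ 2 +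
    ((d / v - v) / 2) * (1 - d - (1 - (d / v + v) / 2) * v) ^ 2

/-- The factorisation isolates the sign: `d - v ^ 2` is nonnegative on the admissible range, so the
quartic alone decides monotonicity. -/
lemma hasDerivAt_cliqueStarCurve (d : ℝ) {v : ℝ} (hv : 0 < v) :
    HasDerivAt (cliqueStarCurve d)
      ((d - v ^ 2) / (8 * v ^ 2) *
        (5 * v ^ 4 - 16 * v ^ 3 + (18 - 4 * d) * v ^ 2 - 3 * d * (2 - d))) v := by
  have hdv : HasDerivAt (fun v : ℝ => d / v) (-d / v ^ 2) v := by
    simpa [div_eq_mul_inv] using (hasDerivAt_inv hv.ne').const_mul d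
  have hq : HasDerivAt (fun v : ℝ => 1 - (d / v + v) / 2) (-((-d / v ^ 2 + 1) / 2)) v :=
    ((hdv.add (hasDerivAt_id v)).div_const 2).const_sub 1
  have hY : HasDerivAt (fun v : ℝ => (d / v - v) / 2) ((-d / v ^ 2 - 1) / 2) v :=
    (hdv.sub (hasDerivAt_id v)).div_const 2
  have hg : HasDerivAt (fun v : ℝ => 1 - d - (1 - (d / v + v) / 2) * v)
      (-(-((-d / v ^ 2 + 1) / 2) * v + (1 - (d / v + v) / 2) * 1)) v :=
    (hq.mul (hasDerivAt_id v)).const_sub (1 - d)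
  have := ((hq.mul_const ((1 - d) ^ 2)).add ((hasDerivAt_id v).mul (hq.pow 2))).add
    (hY.mul (hg.pow 2))
  refine this.congr_deriv ?_
  have hv' := hv.ne'
  norm_num [Pi.pow_apply]
  field_simp
  ring

/-- This is the divided difference between `y` and `x` of the quartic in the derivative of
`cliqueStarCurve`, with `d` replaced by `2 * y - y ^ 2`, its largest value when `y ≥ 1 - √c`. It
makes that quartic increasing. -/
lemma cubic_nonneg {x y : ℝ} (hy : 0 ≤ y) (hyx : y ≤ x) (hx : x ≤ 1) :
    0 ≤ 5 * (x + y) * (x ^ 2 + y ^ 2) - 16 * (x ^ 2 + x * y + y ^ 2) +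
      (18 - 4 * (2 * y - y ^ 2)) * (x + y) := by
  obtain ⟨α, rfl⟩ : ∃ α, x = 1 - α := ⟨1 - x, by ring⟩
  obtain ⟨β, rfl⟩ : ∃ β, y = 1 - β := ⟨1 - y, by ring⟩
  have hα : 0 ≤ α := by linarith
  have hβ : 0 ≤ β := by linarith
  have hα1 : 0 ≤ 1 - α := by linarith
  have hβ1 : 0 ≤ 1 - β := by linarith
  have h1 : 0 ≤ α ^ 2 * (1 - α) := by positivity
  have h2 : 0 ≤ α * β * (1 - α) := by positivity
  have h3 : 0 ≤ β ^ 2 * (1 - β) := by positivity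
  have h4 : 0 ≤ β ^ 2 * (1 - α) := by positivity
  have h5 : 0 ≤ α * (1 - α) := by positivity
  have h6 : 0 ≤ β * (1 - β) := by positivity
  have h7 : 0 ≤ α * (1 - β) := by positivity
  nlinarith

/-- At fixed `c` the isolated width `w = 1 - a` ranges from `1 - √c` (where `p = 0`, the clique) to
`√(1 - c)` (where `p = a`, the star). The quartic `F` increases on this range, so the sign of `F w`
tells towards which endpoint the value does not decrease. -/
lemma cliqueStar_le_starCliqueBound {c a p : ℝ} (hp : 0 ≤ p) (hpa : p ≤ a) (ha : a ≤ 1)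
    (hc : c = a ^ 2 + 2 * p * (1 - a)) :
    p * c ^ 2 + (1 - a) * p ^ 2 + (a - p) * (c - p * (1 - a)) ^ 2 ≤ starCliqueBound c := by
  have hc0 : 0 ≤ c := by rw [hc]; nlinarith
  rcases eq_or_lt_of_le ha with rfl | ha1
  · have : c = 1 := by rw [hc]; ring
    subst this
    refine le_trans (le_of_eq ?_) (clique_le_starCliqueBound hc0)
    simp
  obtain ⟨w, hw⟩ : ∃ w, w = 1 - a := ⟨_, rfl⟩
  obtain ⟨d, hd⟩ : ∃ d, d = 1 - c := ⟨_, rfl⟩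
  have hw0 : 0 < w := by linarith
  have hdw : d = w * (2 * (1 - p) - w) := by rw [hd, hc, hw]; ring
  have hwd : w ^ 2 ≤ d := by rw [hdw]; nlinarith
  have hd0 : 0 < d := lt_of_lt_of_le (by positivity) hwd
  have hdv : d / w = 2 * (1 - p) - w := by rw [hdw]; field_simp
  have hS : p * c ^ 2 + (1 - a) * p ^ 2 + (a - p) * (c - p * (1 - a)) ^ 2 =
      cliqueStarCurve d w := by
    have h1 : 1 - (d / w + w) / 2 = p := by rw [hdv]; ring
    have h2 : (d / w - w) / 2 = a - p := by rw [hdv, hw]; ring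
    rw [cliqueStarCurve, h1, h2, hd, hw]
    ring
  rw [hS]
  set F : ℝ → ℝ := fun v => 5 * v ^ 4 - 16 * v ^ 3 + (18 - 4 * d) * v ^ 2 - 3 * d * (2 - d) with hF
  set r := √c with hr
  set t := √d with ht
  have hr2 : r ^ 2 = c := Real.sq_sqrt hc0
  have ht2 : t ^ 2 = d := Real.sq_sqrt hd0.le
  have hr0 : 0 ≤ r := Real.sqrt_nonneg _
  have ht0 : 0 ≤ t := Real.sqrt_nonneg _
  have hr1 : r < 1 := by nlinarith
  have ht1 : t ≤ 1 := by nlinarith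
  have hrw : 1 - r ≤ w := by
    have : a ≤ r := Real.le_sqrt_of_sq_le (by rw [hc]; nlinarith)
    linarith
  have hwt : w ≤ t := Real.le_sqrt_of_sq_le hwd
  have hFmono : ∀ v v', 1 - r ≤ v → v ≤ v' → v' ≤ t → F v ≤ F v' := by
    intro v v' h1 h2 h3
    have hv1 : v' ≤ 1 := h3.trans ht1
    have hd1 : d ≤ 2 * v - v ^ 2 := by
      have : (1 - v) ^ 2 ≤ r ^ 2 := pow_le_pow_left₀ (by linarith) (by linarith) 2
      rw [hr2] at this
      linarith
    have key : F v' - F v = (v' - v) * (5 * (v' + v) * (v' ^ 2 + v ^ 2)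
      - 16 * (v' ^ 2 + v' * v + v ^ 2) + (18 - 4 * d) * (v' + v)) := by
      simp only [hF]; ring
    have : 0 ≤ 5 * (v' + v) * (v' ^ 2 + v ^ 2)
      - 16 * (v' ^ 2 + v' * v + v ^ 2) + (18 - 4 * d) * (v' + v) := by
      have hv0 : 0 < v := by linarith
      have h4 : (18 - 4 * (2 * v - v ^ 2)) * (v' + v) ≤ (18 - 4 * d) * (v' + v) :=
        mul_le_mul_of_nonneg_right (by linarith) (by linarith)
      exact le_trans (cubic_nonneg hv0.le h2 hv1) (by linarith)
    rw [← sub_nonneg, key]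
    exact mul_nonneg (sub_nonneg.2 h2) this
  have hvd : ∀ v, 0 ≤ v → v ≤ t → 0 ≤ d - v ^ 2 := fun v h0 h1 => by
    rw [← ht2]
    exact sub_nonneg.2 (pow_le_pow_left₀ h0 h1 2)
  have hcont : ContinuousOn (cliqueStarCurve d) (Set.Ioi 0) := fun v hv =>
    (hasDerivAt_cliqueStarCurve d hv).continuousAt.continuousWithinAt
  rcases le_total (F w) 0 with h | h
  · have hanti : AntitoneOn (cliqueStarCurve d) (Set.Icc (1 - r) w) := by
      refine antitoneOn_of_deriv_nonpos (convex_Icc _ _)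
        (hcont.mono fun v hv => lt_of_lt_of_le (by linarith) hv.1) ?_ ?_
      · intro v hv
        rw [interior_Icc] at hv
        exact (hasDerivAt_cliqueStarCurve d (by linarith [hv.1])).differentiableAt.differentiableWithinAt
      · intro v hv
        rw [interior_Icc] at hv
        have hv0 : 0 < v := by linarith [hv.1]
        rw [(hasDerivAt_cliqueStarCurve d hv0).deriv]
        refine mul_nonpos_of_nonneg_of_nonpos (div_nonneg ?_ (by positivity))
          ((hFmono v w hv.1.le hv.2.le hwt).trans h)
        exact hvd v hv0.le (hv.2.le.trans hwt)
    refine (hanti ⟨le_rfl, hrw⟩ ⟨hrw, le_rfl⟩ hrw).trans ?_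
    refine le_trans (le_of_eq ?_) (clique_le_starCliqueBound hc0)
    have h1 : d / (1 - r) = 1 + r := by
      rw [div_eq_iff (by linarith), hd, ← hr2]; ring
    rw [cliqueStarCurve, h1, hd]
    ring
  · have hmono : MonotoneOn (cliqueStarCurve d) (Set.Icc w t) := by
      refine monotoneOn_of_deriv_nonneg (convex_Icc _ _)
        (hcont.mono fun v hv => lt_of_lt_of_le hw0 hv.1) ?_ ?_
      · intro v hv
        rw [interior_Icc] at hv
        exact (hasDerivAt_cliqueStarCurve d (by linarith [hv.1])).differentiableAt.differentiableWithinAt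
      · intro v hv
        rw [interior_Icc] at hv
        have hv0 : 0 < v := by linarith [hv.1]
        rw [(hasDerivAt_cliqueStarCurve d hv0).deriv]
        refine mul_nonneg (div_nonneg ?_ (by positivity))
          (h.trans (hFmono w v hrw hv.1.le hv.2.le))
        exact hvd v hv0.le hv.2.le
    refine (hmono ⟨le_rfl, hwt⟩ ⟨hwt, le_rfl⟩ hwt).trans ?_
    have h1 : d / t = t := by
      rw [div_eq_iff (by linarith : t ≠ 0), ← ht2, sq]
    have hct : c = 1 - t ^ 2 := by rw [ht2, hd]; ring
    have := star_le_starCliqueBound (c := c) (p := 1 - t) (by linarith) (by rw [hct]; ring)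
    refine le_trans (le_of_eq ?_) this
    rw [cliqueStarCurve, h1, ← ht2, hct]
    ring

/-! ### Shapes with two dominating and two isolated blocks and no clique -/

/-- The sum `S` of a threshold shape with two dominating and two isolated blocks, the outer
dominating block having width `p`, as a function of the width `v` of the inner one along a curve of
constant density `c`. -/
noncomputable def twoStarCurve (c p E v : ℝ) : ℝ :=
  p * c ^ 2 + (1 - (p + (E / v + v) / 2)) * p ^ 2 +
    v * (c - p * (1 - (p + (E / v + v) / 2))) ^ 2 +
    (E / v - v) / 2 * (p + (p + (E / v + v) / 2) * v) ^ 2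

/-- The factor that decides the monotonicity of `twoStarCurve`. -/
noncomputable def twoStarSlope (p E v : ℝ) : ℝ :=
  ((E / v - v) / 2) ^ 2 + p * (2 + p) * ((E / v - v) / 2) / v - 3 / 2 * E - 3 / 2 * v ^ 2 -
    2 * p - p ^ 2 - 4 * p * v

lemma hasDerivAt_twoStarCurve {c p E v : ℝ} (hv : 0 < v)
    (hc : c = 1 - (1 - p) ^ 2 + E) :
    HasDerivAt (twoStarCurve c p E) (-((E / v - v) / 2 * v * twoStarSlope p E v)) v := by
  have hdv : HasDerivAt (fun v : ℝ => E / v) (-E / v ^ 2) v := by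
    simpa [div_eq_mul_inv] using (hasDerivAt_inv hv.ne').const_mul E
  have hb : HasDerivAt (fun v : ℝ => p + (E / v + v) / 2) ((-E / v ^ 2 + 1) / 2) v :=
    ((hdv.add (hasDerivAt_id v)).div_const 2).const_add p
  have hb' : HasDerivAt (fun v : ℝ => 1 - (p + (E / v + v) / 2)) (-((-E / v ^ 2 + 1) / 2)) v :=
    hb.const_sub 1
  have hY : HasDerivAt (fun v : ℝ => (E / v - v) / 2) ((-E / v ^ 2 - 1) / 2) v :=
    (hdv.sub (hasDerivAt_id v)).div_const 2
  have hg := ((hb'.const_mul p).const_sub c).pow 2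
  have hh := ((hb.mul (hasDerivAt_id v)).const_add p).pow 2
  have := (((hb'.mul_const (p ^ 2)).const_add (p * c ^ 2)).add ((hasDerivAt_id v).mul hg)).add
    (hY.mul hh)
  refine this.congr_deriv ?_
  have hv' := hv.ne'
  rw [twoStarSlope, hc]
  norm_num [Pi.pow_apply]
  field_simp
  ring

lemma twoStarSlope_le {p E v v' : ℝ} (hp : 0 ≤ p) (hv : 0 < v) (hvv : v ≤ v') (hE : v' ^ 2 ≤ E) :
    twoStarSlope p E v' ≤ twoStarSlope p E v := by
  have hv' : 0 < v' := hv.trans_le hvv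
  have h1 : E / v' ≤ E / v := div_le_div_of_nonneg_left (by nlinarith) hv hvv
  have h2 : 0 ≤ (E / v' - v') / 2 := by
    have : v' ≤ E / v' := by rw [le_div_iff₀ hv']; nlinarith
    linarith
  have h3 : (E / v' - v') / 2 ≤ (E / v - v) / 2 := by linarith
  have h4 : ((E / v' - v') / 2) ^ 2 ≤ ((E / v - v) / 2) ^ 2 := pow_le_pow_left₀ h2 h3 2
  have h5 : p * (2 + p) * ((E / v' - v') / 2) / v' ≤ p * (2 + p) * ((E / v - v) / 2) / v := by
    gcongr
    exact mul_nonneg (by positivity) (h2.trans h3)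
  have h6 : v ^ 2 ≤ v' ^ 2 := pow_le_pow_left₀ hv.le hvv 2
  have h7 : p * v ≤ p * v' := mul_le_mul_of_nonneg_left hvv hp
  unfold twoStarSlope
  linarith

/-- With `p` and `c` fixed, only `w = a - p` varies. At the lower endpoint `b = 1`, and the shape is
a single star of centre `1 - ρ`; at the upper endpoint `b = a`, and the shape belongs to the
previous family. Because `twoStarSlope` decreases, its sign at `w` selects the endpoint. -/
lemma twoStar_le_starCliqueBound {c p a b : ℝ} (hp : 0 ≤ p) (hpa : p ≤ a) (hab : a ≤ b)
    (hb : b ≤ 1) (hc : c = 1 - (1 - p) ^ 2 + (a - p) * (2 * b - a - p)) :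
    p * c ^ 2 + (1 - b) * p ^ 2 + (a - p) * (c - p * (1 - b)) ^ 2 +
      (b - a) * (p + b * (a - p)) ^ 2 ≤ starCliqueBound c := by
  rcases eq_or_lt_of_le hpa with rfl | hpa'
  · refine le_trans (le_of_eq ?_) (star_le_starCliqueBound (c := c) (p := p) (by linarith) ?_)
    · ring
    · rw [hc]; ring
  obtain ⟨w, hw⟩ : ∃ w, w = a - p := ⟨_, rfl⟩
  obtain ⟨E, hE⟩ : ∃ E, E = w * (2 * (b - p) - w) := ⟨_, rfl⟩
  have hw0 : 0 < w := by linarith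
  have hcE : c = 1 - (1 - p) ^ 2 + E := by rw [hc, hE, hw]; ring
  have hwE : w ^ 2 ≤ E := by rw [hE]; nlinarith
  have hE0 : 0 < E := lt_of_lt_of_le (by positivity) hwE
  have hEv : E / w = 2 * (b - p) - w := by rw [hE]; field_simp
  have hS : p * c ^ 2 + (1 - b) * p ^ 2 + (a - p) * (c - p * (1 - b)) ^ 2 +
      (b - a) * (p + b * (a - p)) ^ 2 = twoStarCurve c p E w := by
    have h1 : p + (E / w + w) / 2 = b := by rw [hEv]; ring
    have h2 : (E / w - w) / 2 = b - a := by rw [hEv, hw]; ring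
    rw [twoStarCurve, h1, h2, hw]
  rw [hS]
  have hcont : ContinuousOn (twoStarCurve c p E) (Set.Ioi 0) := fun v hv =>
    (hasDerivAt_twoStarCurve hv hcE).continuousAt.continuousWithinAt
  have hdiff : ∀ v, 0 < v → DifferentiableAt ℝ (twoStarCurve c p E) v := fun v hv =>
    (hasDerivAt_twoStarCurve hv hcE).differentiableAt
  have hY : ∀ v, 0 < v → v ^ 2 ≤ E → 0 ≤ (E / v - v) / 2 * v := fun v hv h => by
    have : (E / v - v) / 2 * v = (E - v ^ 2) / 2 := by field_simp
    rw [this]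
    linarith
  rcases le_total 0 (twoStarSlope p E w) with h | h
  · obtain ⟨β, hβ⟩ : ∃ β, β = 1 - p := ⟨_, rfl⟩
    have hEβ : (β - w) ^ 2 ≤ β ^ 2 - E := by rw [hE, hβ]; nlinarith
    have hρ2 : √(β ^ 2 - E) ^ 2 = β ^ 2 - E := Real.sq_sqrt ((sq_nonneg _).trans hEβ)
    have hρ0 : 0 ≤ √(β ^ 2 - E) := Real.sqrt_nonneg _
    have hρw : β - w ≤ √(β ^ 2 - E) := Real.le_sqrt_of_sq_le hEβ
    set ρ := √(β ^ 2 - E)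
    have hβ0 : 0 < β := by linarith
    have hρβ : ρ < β := by
      refine lt_of_pow_lt_pow_left₀ 2 hβ0.le ?_
      rw [hρ2]
      linarith
    have hanti : AntitoneOn (twoStarCurve c p E) (Set.Icc (β - ρ) w) := by
      refine antitoneOn_of_deriv_nonpos (convex_Icc _ _)
        (hcont.mono fun v hv => lt_of_lt_of_le (by linarith) hv.1) ?_ ?_
      · intro v hv
        rw [interior_Icc] at hv
        exact (hdiff v (by linarith [hv.1])).differentiableWithinAt
      · intro v hv
        rw [interior_Icc] at hv
        have hv0 : 0 < v := by linarith [hv.1]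
        rw [(hasDerivAt_twoStarCurve hv0 hcE).deriv, Left.neg_nonpos_iff]
        exact mul_nonneg (hY v hv0 ((pow_le_pow_left₀ hv0.le hv.2.le 2).trans hwE))
          (h.trans (twoStarSlope_le hp hv0 hv.2.le hwE))
    refine (hanti ⟨le_rfl, by linarith⟩ ⟨by linarith, le_rfl⟩ (by linarith)).trans ?_
    have h1 : E / (β - ρ) = β + ρ := by
      rw [div_eq_iff (by linarith)]
      linarith [hρ2, sq_sub_sq β ρ]
    have hEe : E = β ^ 2 - ρ ^ 2 := by linarith
    have hp' : p = 1 - β := by linarith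
    refine le_trans (le_of_eq ?_)
      (star_le_starCliqueBound (c := c) (p := 1 - ρ) (by linarith) ?_)
    · rw [twoStarCurve, h1, hcE, hEe, hp']
      ring
    · rw [hcE, hEe, hp']
      ring
  · obtain ⟨t, ht⟩ : ∃ t, t = √E := ⟨_, rfl⟩
    have ht2 : t ^ 2 = E := by rw [ht]; exact Real.sq_sqrt hE0.le
    have hwt : w ≤ t := by rw [ht]; exact Real.le_sqrt_of_sq_le hwE
    have hmono : MonotoneOn (twoStarCurve c p E) (Set.Icc w t) := by
      refine monotoneOn_of_deriv_nonneg (convex_Icc _ _)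
        (hcont.mono fun v hv => lt_of_lt_of_le hw0 hv.1) ?_ ?_
      · intro v hv
        rw [interior_Icc] at hv
        exact (hdiff v (by linarith [hv.1])).differentiableWithinAt
      · intro v hv
        rw [interior_Icc] at hv
        have hv0 : 0 < v := by linarith [hv.1]
        have hvE : v ^ 2 ≤ E := by
          rw [← ht2]; exact pow_le_pow_left₀ hv0.le hv.2.le 2
        rw [(hasDerivAt_twoStarCurve hv0 hcE).deriv, Left.nonneg_neg_iff]
        exact mul_nonpos_of_nonneg_of_nonpos (hY v hv0 hvE)
          ((twoStarSlope_le hp hw0 hv.1.le hvE).trans h)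
    refine (hmono ⟨le_rfl, hwt⟩ ⟨hwt, le_rfl⟩ hwt).trans ?_
    have h1 : E / t = t := by
      rw [div_eq_iff (by linarith : t ≠ 0), ← ht2, sq]
    have htb : t ≤ b - p := by
      refine le_of_sq_le_sq ?_ (by linarith)
      rw [ht2, hE]
      nlinarith [sq_nonneg (b - p - w)]
    refine le_trans (le_of_eq ?_)
      (cliqueStar_le_starCliqueBound (c := c) (a := p + t) (p := p) hp (by linarith) (by linarith) ?_)
    · rw [twoStarCurve, h1]
      rw [hcE, ← ht2]
      ring
    · rw [hcE, ← ht2]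
      ring

/-! ### Threshold shapes encoded as lists -/

/-- The value of `S` at the threshold shape encoded by a list: a pair `(x, y)` stands for a block of
width `x` adjacent to all later blocks, followed by a block of width `y` adjacent to none of them;
the remaining block is a clique. `X` and `1 - V` are the total widths of the blocks of either kind
met so far, and `N` is the sum of `width * degree` over those of the second kind. -/
noncomputable def thresholdSum (c : ℝ) : ℝ → ℝ → ℝ → List (ℝ × ℝ) → ℝ
  | X, V, N, [] => (V - X) * (c - N) ^ 2
  | X, V, N, (x, y) :: l =>
    x * (c - N) ^ 2 + y * (N + (X + x) * V) ^ 2 +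
      thresholdSum c (X + x) (V - y) (N + y * (X + x)) l

/-- The list encodes a threshold shape of density `c`. -/
def IsThresholdList (c : ℝ) : ℝ → ℝ → ℝ → List (ℝ × ℝ) → Prop
  | X, V, N, [] => X ≤ V ∧ c = V ^ 2 + 2 * N
  | X, V, N, (x, y) :: l =>
    0 ≤ x ∧ 0 ≤ y ∧ IsThresholdList c (X + x) (V - y) (N + y * (X + x)) l

lemma IsThresholdList.le {c : ℝ} : ∀ {l : List (ℝ × ℝ)} {X V N : ℝ},
    IsThresholdList c X V N l → X ≤ V
  | [], _, _, _, h => h.1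
  | (_, _) :: _, _, _, _, ⟨hx, hy, h⟩ => by linarith [IsThresholdList.le h]

/-- Half the second derivative of `B * s + C * s ^ 2 + D * s ^ 3` is the affine function `C + 3 * D
* s`. It is nonnegative at both ends, so the cubic is convex on `[-s₀, s₁]`, and its value 0 at the
origin is at most one of the end values. -/
lemma cubic_endpoint {B C D s₀ s₁ : ℝ} (hC : 0 ≤ C) (h₁ : 0 ≤ C + 3 * D * s₁)
    (h₀ : 0 ≤ C - 3 * D * s₀) (hs₀ : 0 ≤ s₀) (hs₁ : 0 ≤ s₁) :
    0 ≤ B * s₁ + C * s₁ ^ 2 + D * s₁ ^ 3 ∨ 0 ≤ -B * s₀ + C * s₀ ^ 2 - D * s₀ ^ 3 := by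
  rcases le_total 0 B with hB | hB
  · left
    have : 0 ≤ s₁ ^ 2 * (C + D * s₁) := mul_nonneg (sq_nonneg _) (by linarith)
    have := mul_nonneg hB hs₁
    linarith
  · right
    have : 0 ≤ s₀ ^ 2 * (C - D * s₀) := mul_nonneg (sq_nonneg _) (by linarith)
    have := mul_nonneg (neg_nonneg.2 hB) hs₀
    linarith

section merging

variable {c X V N : ℝ} {l : List (ℝ × ℝ)}

lemma thresholdSum_merge_first (x₁ x₂ y : ℝ) :
    thresholdSum c X V N ((x₁, 0) :: (x₂, y) :: l) = thresholdSum c X V N ((x₁ + x₂, y) :: l) := by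
  simp only [thresholdSum, zero_mul, add_zero, sub_zero, add_assoc]
  ring

lemma isThresholdList_merge_first {x₁ x₂ y : ℝ}
    (h : IsThresholdList c X V N ((x₁, 0) :: (x₂, y) :: l)) :
    IsThresholdList c X V N ((x₁ + x₂, y) :: l) := by
  simp only [IsThresholdList, zero_mul, add_zero, sub_zero, add_assoc] at h ⊢
  exact ⟨by linarith, h.2.2.2.1, h.2.2.2.2⟩

lemma thresholdSum_merge_second (x y₁ y₂ : ℝ) :
    thresholdSum c X V N ((x, y₁) :: (0, y₂) :: l) = thresholdSum c X V N ((x, y₁ + y₂) :: l) := by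
  simp only [thresholdSum, add_zero]
  rw [show V - y₁ - y₂ = V - (y₁ + y₂) by ring,
    show N + y₁ * (X + x) + y₂ * (X + x) = N + (y₁ + y₂) * (X + x) by ring]
  ring

lemma isThresholdList_merge_second {x y₁ y₂ : ℝ}
    (h : IsThresholdList c X V N ((x, y₁) :: (0, y₂) :: l)) :
    IsThresholdList c X V N ((x, y₁ + y₂) :: l) := by
  simp only [IsThresholdList, add_zero] at h ⊢
  refine ⟨h.1, by linarith [h.2.1, h.2.2.2.1], ?_⟩
  rw [show V - (y₁ + y₂) = V - y₁ - y₂ by ring,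
    show N + (y₁ + y₂) * (X + x) = N + y₁ * (X + x) + y₂ * (X + x) by ring]
  exact h.2.2.2.2

lemma thresholdSum_merge_last (x : ℝ) :
    thresholdSum c X V N [(x, 0)] = thresholdSum c X V N [] := by
  simp only [thresholdSum, zero_mul, add_zero, sub_zero]
  ring

lemma isThresholdList_merge_last {x : ℝ} (h : IsThresholdList c X V N [(x, 0)]) :
    IsThresholdList c X V N [] := by
  simp only [IsThresholdList, zero_mul, add_zero, sub_zero] at h ⊢
  exact ⟨by linarith [h.2.2.1], h.2.2.2⟩

end merging

/-- The list `l'` encodes the same threshold shapes as `l`. -/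
def MergesTo (c : ℝ) (l l' : List (ℝ × ℝ)) : Prop :=
  ∀ X V N, (IsThresholdList c X V N l → IsThresholdList c X V N l') ∧
    thresholdSum c X V N l = thresholdSum c X V N l'

section MergesTo

variable {c : ℝ} {l l' : List (ℝ × ℝ)}

lemma MergesTo.cons (h : MergesTo c l l') (a : ℝ × ℝ) : MergesTo c (a :: l) (a :: l') :=
  fun X V N => ⟨fun hl => ⟨hl.1, hl.2.1, (h _ _ _).1 hl.2.2⟩, by
    simp only [thresholdSum]
    rw [(h _ _ _).2]⟩

lemma mergesTo_first (x₁ x₂ y : ℝ) : MergesTo c ((x₁, 0) :: (x₂, y) :: l) ((x₁ + x₂, y) :: l) :=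
  fun _ _ _ => ⟨isThresholdList_merge_first, thresholdSum_merge_first _ _ _⟩

lemma mergesTo_second (x y₁ y₂ : ℝ) :
    MergesTo c ((x, y₁) :: (0, y₂) :: l) ((x, y₁ + y₂) :: l) :=
  fun _ _ _ => ⟨isThresholdList_merge_second, thresholdSum_merge_second _ _ _⟩

lemma mergesTo_last (x : ℝ) : MergesTo c [(x, 0)] [] :=
  fun _ _ _ => ⟨isThresholdList_merge_last, thresholdSum_merge_last _⟩

/-- A block of width zero lets its two neighbours of the other kind fuse. The case `y₃ = 0` depends
on the tail: if `l` is empty, the last dominating block is absorbed by the clique. -/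
lemma exists_mergesTo_of_eq_zero {x₁ x₂ x₃ y₁ y₂ y₃ : ℝ} (l : List (ℝ × ℝ))
    (h : y₁ = 0 ∨ y₂ = 0 ∨ y₃ = 0 ∨ x₂ = 0 ∨ x₃ = 0) :
    ∃ l' : List (ℝ × ℝ), l'.length < l.length + 3 ∧
      MergesTo c ((x₁, y₁) :: (x₂, y₂) :: (x₃, y₃) :: l) l' := by
  rcases h with rfl | rfl | rfl | rfl | rfl
  · exact ⟨_, by simp, mergesTo_first _ _ _⟩
  · exact ⟨_, by simp, (mergesTo_first _ _ _).cons _⟩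
  · match l with
    | [] => exact ⟨_, by simp, ((mergesTo_last _).cons _).cons _⟩
    | (x₄, y₄) :: l => exact ⟨_, by simp, ((mergesTo_first _ _ _).cons _).cons _⟩
  · exact ⟨_, by simp, mergesTo_second _ _ _⟩
  · exact ⟨_, by simp, (mergesTo_second _ _ _).cons _⟩

end MergesTo

/-! ### Moving width between isolated blocks -/

/-- The part of `thresholdSum` which depends on `y₁, y₂, y₃` when those vary with fixed sum and
fixed density. -/
noncomputable def isolatedPart (c x₁ x₂ x₃ k y₁ y₂ y₃ : ℝ) : ℝ :=
  y₁ * x₁ ^ 2 + x₂ * (c - y₁ * x₁) ^ 2 + y₂ * (y₁ * x₁ + (x₁ + x₂) * (1 - y₁)) ^ 2 +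
    x₃ * (c - y₁ * x₁ - y₂ * (x₁ + x₂)) ^ 2 + y₃ * k ^ 2

/-- A move of mass between the isolated parts of three consecutive blocks which keeps the density
and makes one of them vanish. -/
lemma exists_isolatedPart_le {x₁ x₂ x₃ y₁ y₂ y₃ : ℝ} (c k : ℝ) (hx₁ : 0 ≤ x₁) (hx₂ : 0 < x₂)
    (hx₃ : 0 < x₃) (hy₁ : 0 ≤ y₁) (hy₂ : 0 ≤ y₂) (hy₃ : 0 ≤ y₃) (hy : y₁ + y₂ + y₃ ≤ 1) :
    ∃ z₁ z₂ z₃ : ℝ, 0 ≤ z₁ ∧ 0 ≤ z₂ ∧ 0 ≤ z₃ ∧ (z₁ = 0 ∨ z₂ = 0 ∨ z₃ = 0) ∧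
      z₁ + z₂ + z₃ = y₁ + y₂ + y₃ ∧
      z₁ * x₁ + z₂ * (x₁ + x₂) + z₃ * (x₁ + x₂ + x₃) =
        y₁ * x₁ + y₂ * (x₁ + x₂) + y₃ * (x₁ + x₂ + x₃) ∧
      isolatedPart c x₁ x₂ x₃ k y₁ y₂ y₃ ≤ isolatedPart c x₁ x₂ x₃ k z₁ z₂ z₃ := by
  -- The move adds `s * (x₃, -(x₂ + x₃), x₂)` to `(y₁, y₂, y₃)`, the direction that keeps both the
  -- total width and the density. `s₁` is the forward step that empties `y₂`; `s₀` is the longest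
  -- backward step, emptying `y₁` or `y₃`.
  obtain ⟨s₁, hs₁⟩ : ∃ s, s = y₂ / (x₂ + x₃) := ⟨_, rfl⟩
  obtain ⟨s₀, hs₀⟩ : ∃ s, s = min (y₁ / x₃) (y₃ / x₂) := ⟨_, rfl⟩
  have hs₁0 : 0 ≤ s₁ := by rw [hs₁]; positivity
  have hs₀0 : 0 ≤ s₀ := by rw [hs₀]; exact le_min (by positivity) (by positivity)
  have e₁ : s₁ * (x₂ + x₃) = y₂ := by rw [hs₁]; field_simp
  have e₀ : s₀ * x₃ ≤ y₁ := by
    rw [← le_div_iff₀ hx₃, hs₀]; exact min_le_left _ _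
  have e₀' : s₀ * x₂ ≤ y₃ := by
    rw [← le_div_iff₀ hx₂, hs₀]; exact min_le_right _ _
  have e₀'' : y₁ - s₀ * x₃ = 0 ∨ y₃ - s₀ * x₂ = 0 := by
    rcases min_choice (y₁ / x₃) (y₃ / x₂) with h | h
    · left; rw [hs₀, h]; field_simp; ring
    · right; rw [hs₀, h]; field_simp; ring
  -- coefficients of the cubic polynomial in the size of the move
  obtain ⟨Z, hZ⟩ : ∃ Z : ℝ → ℝ, ∀ y, Z y = y * x₁ + (x₁ + x₂) * (1 - y) := ⟨_, fun _ => rfl⟩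
  obtain ⟨K, hK⟩ : ∃ K, K = x₂ * (x₁ * x₃) ^ 2 + x₃ * (x₂ * (x₁ + x₂ + x₃)) ^ 2 := ⟨_, rfl⟩
  have hK0 : 0 ≤ K := by rw [hK]; positivity
  obtain ⟨Q, hQ⟩ : ∃ Q : ℝ → ℝ → ℝ, ∀ a b, Q a b = K + b * (x₂ * x₃) ^ 2 +
    2 * (x₂ + x₃) * (x₂ * x₃) * Z a := ⟨_, fun _ _ => rfl⟩
  have hQ0 : ∀ a b, 0 ≤ a → a ≤ 1 → 0 ≤ b → 0 ≤ Q a b := by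
    intro a b ha ha1 hb
    have : 0 ≤ Z a := by
      rw [hZ]
      exact add_nonneg (by positivity) (mul_nonneg (by positivity) (by linarith))
    rw [hQ]
    positivity
  obtain ⟨D, hD⟩ : ∃ D, D = -((x₂ + x₃) * (x₂ * x₃) ^ 2) := ⟨_, rfl⟩
  obtain ⟨B, hB⟩ : ∃ B, B = isolatedPart c x₁ x₂ x₃ k (y₁ + x₃) (y₂ - (x₂ + x₃)) (y₃ + x₂) -
    isolatedPart c x₁ x₂ x₃ k y₁ y₂ y₃ - Q y₁ y₂ - D := ⟨_, rfl⟩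
  have hcub : ∀ s, isolatedPart c x₁ x₂ x₃ k (y₁ + s * x₃) (y₂ - s * (x₂ + x₃)) (y₃ + s * x₂) =
      isolatedPart c x₁ x₂ x₃ k y₁ y₂ y₃ + (B * s + Q y₁ y₂ * s ^ 2 + D * s ^ 3) := by
    intro s
    rw [hB, hQ, hZ, hD, hK]
    simp only [isolatedPart]
    ring
  -- Half the second derivative along the move is `Q` at the moved point, so convexity reduces to `Q
  -- ≥ 0` at admissible points.
  have hQD : ∀ s, Q y₁ y₂ + 3 * D * s = Q (y₁ + s * x₃) (y₂ - s * (x₂ + x₃)) := by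
    intro s
    rw [hQ, hQ, hZ, hZ, hD]
    ring
  rcases cubic_endpoint (B := B) (C := Q y₁ y₂) (D := D) (s₀ := s₀) (s₁ := s₁)
    (hQ0 _ _ hy₁ (by linarith) hy₂)
    (by
      rw [hQD]
      refine hQ0 _ _ (by positivity) ?_ (by linarith)
      nlinarith)
    (by
      rw [show Q y₁ y₂ - 3 * D * s₀ = Q y₁ y₂ + 3 * D * (-s₀) by ring, hQD]
      refine hQ0 _ _ (by linarith) ?_ ?_
      · nlinarith
      · nlinarith)
    hs₀0 hs₁0 with h | h
  · refine ⟨y₁ + s₁ * x₃, y₂ - s₁ * (x₂ + x₃), y₃ + s₁ * x₂, by positivity, by linarith,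
      by positivity, Or.inr (Or.inl (by linarith)), by ring, by ring, ?_⟩
    rw [hcub]
    linarith
  · refine ⟨y₁ + (-s₀) * x₃, y₂ - (-s₀) * (x₂ + x₃), y₃ + (-s₀) * x₂, by linarith, ?_, by linarith,
      ?_, by ring, by ring, ?_⟩
    · have : 0 ≤ s₀ * (x₂ + x₃) := by positivity
      linarith
    · rcases e₀'' with h | h
      · left; linarith
      · right; right; linarith
    · rw [hcub]
      linarith

/-- The tail, and the constant `k` in `isolatedPart`, see the `yᵢ` only through their sum and their
contribution to the density. Both are conserved by the move. -/
lemma thresholdSum_three (c x₁ x₂ x₃ y₁ y₂ y₃ : ℝ) (l : List (ℝ × ℝ)) :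
    thresholdSum c 0 1 0 ((x₁, y₁) :: (x₂, y₂) :: (x₃, y₃) :: l) =
      x₁ * c ^ 2 + isolatedPart c x₁ x₂ x₃
        (y₁ * x₁ + y₂ * (x₁ + x₂) + y₃ * (x₁ + x₂ + x₃) +
          (x₁ + x₂ + x₃) * (1 - (y₁ + y₂ + y₃))) y₁ y₂ y₃ +
      thresholdSum c (x₁ + x₂ + x₃) (1 - (y₁ + y₂ + y₃))
        (y₁ * x₁ + y₂ * (x₁ + x₂) + y₃ * (x₁ + x₂ + x₃)) l := by
  simp only [thresholdSum, isolatedPart, zero_add, sub_zero, sub_sub, add_assoc]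
  ring

lemma isThresholdList_three {c x₁ x₂ x₃ y₁ y₂ y₃ : ℝ} {l : List (ℝ × ℝ)} :
    IsThresholdList c 0 1 0 ((x₁, y₁) :: (x₂, y₂) :: (x₃, y₃) :: l) ↔
      0 ≤ x₁ ∧ 0 ≤ y₁ ∧ 0 ≤ x₂ ∧ 0 ≤ y₂ ∧ 0 ≤ x₃ ∧ 0 ≤ y₃ ∧
      IsThresholdList c (x₁ + x₂ + x₃) (1 - (y₁ + y₂ + y₃))
        (y₁ * x₁ + y₂ * (x₁ + x₂) + y₃ * (x₁ + x₂ + x₃)) l := by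
  simp only [IsThresholdList, zero_add, sub_sub, add_assoc]

/-! ### Threshold lists of length at most two -/

lemma starCliqueBound_nonneg {c : ℝ} (hc : 0 ≤ c) : 0 ≤ starCliqueBound c :=
  le_trans (by positivity) (clique_le_starCliqueBound hc)

/-- An isolated block of degree zero only rescales the rest: with `c = b ^ 2 * c'`, `S` scales by `b
^ 5`. The scaled clique is again a clique; the scaled star is a shape of the second family with `p =
0`. -/
lemma cliqueStar_scaled_le {c p a b : ℝ} (hp : 0 ≤ p) (hpa : p ≤ a) (hab : a ≤ b) (hb : b ≤ 1)
    (hc : c = a ^ 2 + 2 * p * (b - a)) :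
    p * c ^ 2 + (b - a) * (p * b) ^ 2 + (a - p) * (c - p * (b - a)) ^ 2 ≤ starCliqueBound c := by
  have hc0 : 0 ≤ c := by rw [hc]; nlinarith
  rcases eq_or_lt_of_le ((hp.trans hpa).trans hab) with h | hb0
  · have ha : a = 0 := by linarith
    have hp0 : p = 0 := by linarith
    refine le_trans (le_of_eq ?_) (starCliqueBound_nonneg hc0)
    rw [hc, ← h, ha, hp0]
    ring
  obtain ⟨c', hc'⟩ : ∃ c', c' = (a / b) ^ 2 + 2 * (p / b) * (1 - a / b) := ⟨_, rfl⟩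
  have hcc : c = b ^ 2 * c' := by rw [hc, hc']; field_simp
  have hc'0 : 0 ≤ c' := by
    have : c' = c / b ^ 2 := by rw [hcc]; field_simp
    rw [this]; positivity
  have hab' : a / b ≤ 1 := (div_le_one hb0).2 hab
  have hpa' : p / b ≤ a / b := by gcongr
  have hc'1 : c' ≤ 1 := by
    have h1 : 0 ≤ (1 - a / b) * (1 - p / b) := mul_nonneg (by linarith) (by linarith)
    have h2 : 0 ≤ (1 - a / b) * (a / b - p / b) := mul_nonneg (by linarith) (by linarith)
    rw [hc']
    linarith
  have key := cliqueStar_le_starCliqueBound (div_nonneg hp hb0.le) hpa' hab' hc'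
  have hS : p * c ^ 2 + (b - a) * (p * b) ^ 2 + (a - p) * (c - p * (b - a)) ^ 2 =
      b ^ 5 * (p / b * c' ^ 2 + (1 - a / b) * (p / b) ^ 2 +
        (a / b - p / b) * (c' - p / b * (1 - a / b)) ^ 2) := by
    rw [hcc]; field_simp
  rw [hS]
  have hb5 : 0 ≤ b ^ 5 := by positivity
  refine (mul_le_mul_of_nonneg_left key hb5).trans ?_
  rw [starCliqueBound, mul_max_of_nonneg _ _ hb5]
  refine max_le ?_ ?_
  · obtain ⟨r, hr⟩ : ∃ r, r = √(1 - c') := ⟨_, rfl⟩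
    have hr2 : r ^ 2 = 1 - c' := by rw [hr]; exact Real.sq_sqrt (by linarith)
    have hr0 : 0 ≤ r := by rw [hr]; exact Real.sqrt_nonneg _
    have hr1 : r ≤ 1 := by nlinarith
    have hc'r : c' = 1 - r ^ 2 := by linarith
    have := twoStar_le_starCliqueBound (c := c) (p := 0) (a := b * (1 - r)) (b := b) le_rfl
      (mul_nonneg hb0.le (by linarith)) (by nlinarith) hb (by rw [hcc, hc'r]; ring)
    refine le_trans (le_of_eq ?_) this
    rw [← hr, hcc, hc'r]
    ring
  · refine le_trans (le_of_eq ?_) (clique_le_starCliqueBound hc0)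
    rw [rpow_five_halves hc'0, hcc, Real.sqrt_mul (by positivity), Real.sqrt_sq hb0.le]
    ring

/-- `thresholdSum` of a list of length two, in terms of the partial sums `x₁` and `X₂ = x₁ + x₂`. -/
noncomputable def dominatingPart (c a n x₁ X₂ y₁ y₂ : ℝ) : ℝ :=
  x₁ * c ^ 2 + y₁ * x₁ ^ 2 + (X₂ - x₁) * (c - y₁ * x₁) ^ 2 +
    y₂ * (y₁ * x₁ + X₂ * (1 - y₁)) ^ 2 + (a - X₂) * (c - n) ^ 2

lemma thresholdSum_two (c x₁ x₂ y₁ y₂ : ℝ) :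
    thresholdSum c 0 1 0 [(x₁, y₁), (x₂, y₂)] =
      dominatingPart c (1 - y₁ - y₂) (y₁ * x₁ + y₂ * (x₁ + x₂)) x₁ (x₁ + x₂) y₁ y₂ := by
  simp only [thresholdSum, dominatingPart, zero_add, sub_zero]
  ring

/-- A move of mass between the dominating parts of two blocks which keeps the density and empties
one of them or the clique. -/
lemma exists_dominatingPart_le {c a n x₁ X₂ y₁ y₂ : ℝ} (hx₁ : 0 ≤ x₁) (hX₂ : x₁ ≤ X₂)
    (ha : X₂ ≤ a) (hy₁ : 0 < y₁) (hy₂ : 0 < y₂) (hy : a + y₁ + y₂ = 1)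
    (hn : n = y₁ * x₁ + y₂ * X₂) (hc : c = a ^ 2 + 2 * n) :
    ∃ u U : ℝ, 0 ≤ u ∧ u ≤ U ∧ U ≤ a ∧ (u = 0 ∨ u = U ∨ U = a) ∧ n = y₁ * u + y₂ * U ∧
      dominatingPart c a n x₁ X₂ y₁ y₂ ≤ dominatingPart c a n u U y₁ y₂ := by
  obtain ⟨s₁, hs₁⟩ : ∃ s, s = (X₂ - x₁) / (y₁ + y₂) := ⟨_, rfl⟩
  obtain ⟨s₀, hs₀⟩ : ∃ s, s = min (x₁ / y₂) ((a - X₂) / y₁) := ⟨_, rfl⟩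
  have hs₁0 : 0 ≤ s₁ := by rw [hs₁]; exact div_nonneg (by linarith) (by linarith)
  have hs₀0 : 0 ≤ s₀ := by
    rw [hs₀]; exact le_min (by positivity) (div_nonneg (by linarith) hy₁.le)
  have e₁ : s₁ * (y₁ + y₂) = X₂ - x₁ := by rw [hs₁]; field_simp
  have e₀ : s₀ * y₂ ≤ x₁ := by
    rw [← le_div_iff₀ hy₂, hs₀]; exact min_le_left _ _
  have e₀' : s₀ * y₁ ≤ a - X₂ := by
    rw [← le_div_iff₀ hy₁, hs₀]; exact min_le_right _ _
  have e₀'' : x₁ - s₀ * y₂ = 0 ∨ a - X₂ - s₀ * y₁ = 0 := by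
    rcases min_choice (x₁ / y₂) ((a - X₂) / y₁) with h | h
    · left; rw [hs₀, h]; field_simp; ring
    · right; rw [hs₀, h]; field_simp; ring
  have hcx : ∀ u U, 0 ≤ u → u ≤ U → U ≤ a → n = y₁ * u + y₂ * U → 2 * (y₁ * u) ≤ c := by
    intro u U hu hU hUa h
    have := mul_nonneg hy₂.le (hu.trans hU)
    have := sq_nonneg a
    linarith
  obtain ⟨Q, hQ⟩ : ∃ Q : ℝ → ℝ → ℝ, ∀ u U, Q u U =
    y₁ * y₂ ^ 2 * (2 * c - 3 * (y₁ * u) + 1 + y₁ * U) + 2 * y₁ ^ 2 * y₂ * (c - y₁ * u) +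
      y₂ * (y₁ * y₂ - y₁ * (1 - y₁)) ^ 2 := ⟨_, fun _ _ => rfl⟩
  have hQ0 : ∀ u U, 0 ≤ u → u ≤ U → U ≤ a → n = y₁ * u + y₂ * U → 0 ≤ Q u U := by
    intro u U hu hU hUa h
    have h1 := hcx u U hu hU hUa h
    have h2 := mul_nonneg hy₁.le hu
    have h3 := mul_nonneg hy₁.le (hu.trans hU)
    rw [hQ]
    have h4 : 0 ≤ 2 * c - 3 * (y₁ * u) + 1 + y₁ * U := by linarith
    have h5 : 0 ≤ c - y₁ * u := by linarith
    positivity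
  obtain ⟨D, hD⟩ : ∃ D, D = -(y₁ ^ 2 * y₂ ^ 3) - y₁ ^ 3 * y₂ ^ 2 := ⟨_, rfl⟩
  obtain ⟨B, hB⟩ : ∃ B, B = dominatingPart c a n (x₁ + y₂) (X₂ - y₁) y₁ y₂ -
    dominatingPart c a n x₁ X₂ y₁ y₂ - Q x₁ X₂ - D := ⟨_, rfl⟩
  have hcub : ∀ s, dominatingPart c a n (x₁ + s * y₂) (X₂ - s * y₁) y₁ y₂ =
      dominatingPart c a n x₁ X₂ y₁ y₂ + (B * s + Q x₁ X₂ * s ^ 2 + D * s ^ 3) := by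
    intro s
    rw [hB, hQ, hD]
    simp only [dominatingPart]
    ring
  have hQD : ∀ s, Q x₁ X₂ + 3 * D * s = Q (x₁ + s * y₂) (X₂ - s * y₁) := by
    intro s
    rw [hQ, hQ, hD]
    ring
  have e₁' : 0 ≤ s₁ * y₁ := by positivity
  have e₁'' : 0 ≤ s₁ * y₂ := by positivity
  have e₂' : 0 ≤ s₀ * y₁ := by positivity
  have e₂'' : 0 ≤ s₀ * y₂ := by positivity
  rcases cubic_endpoint (B := B) (C := Q x₁ X₂) (D := D) (s₀ := s₀) (s₁ := s₁)
    (hQ0 _ _ hx₁ hX₂ ha hn)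
    (by
      rw [hQD]
      exact hQ0 _ _ (by linarith) (by linarith) (by linarith) (by rw [hn]; ring))
    (by
      rw [show Q x₁ X₂ - 3 * D * s₀ = Q x₁ X₂ + 3 * D * (-s₀) by ring, hQD]
      exact hQ0 _ _ (by linarith) (by linarith) (by linarith) (by rw [hn]; ring))
    hs₀0 hs₁0 with h | h
  · refine ⟨x₁ + s₁ * y₂, X₂ - s₁ * y₁, by linarith, by linarith, by linarith,
      Or.inr (Or.inl (by linarith)), by rw [hn]; ring, ?_⟩
    rw [hcub]
    linarith
  · refine ⟨x₁ + (-s₀) * y₂, X₂ - (-s₀) * y₁, by linarith, by linarith, by linarith,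
      ?_, by rw [hn]; ring, ?_⟩
    · rcases e₀'' with h | h
      · left; linarith
      · right; right; linarith
    · rw [hcub]
      linarith

lemma thresholdSum_one_le {c x y : ℝ} (h : IsThresholdList c 0 1 0 [(x, y)]) :
    thresholdSum c 0 1 0 [(x, y)] ≤ starCliqueBound c := by
  simp only [IsThresholdList, zero_add] at h
  obtain ⟨hx, hy, h1, h2⟩ := h
  refine le_trans (le_of_eq ?_) (cliqueStar_le_starCliqueBound (c := c) (a := 1 - y) hx h1
    (by linarith) (by rw [h2]; ring))
  simp only [thresholdSum]
  ring

lemma thresholdSum_two_le {c x₁ x₂ y₁ y₂ : ℝ}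
    (h : IsThresholdList c 0 1 0 [(x₁, y₁), (x₂, y₂)]) :
    thresholdSum c 0 1 0 [(x₁, y₁), (x₂, y₂)] ≤ starCliqueBound c := by
  have h' := h
  simp only [IsThresholdList, zero_add] at h'
  obtain ⟨hx₁, hy₁, hx₂, hy₂, h1, h2⟩ := h'
  rcases eq_or_lt_of_le hy₁ with rfl | hy₁
  · obtain ⟨hl, hS⟩ := mergesTo_first (c := c) (l := []) x₁ x₂ y₂ 0 1 0
    exact hS ▸ thresholdSum_one_le (hl h)
  rcases eq_or_lt_of_le hy₂ with rfl | hy₂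
  · obtain ⟨hl, hS⟩ := (mergesTo_last (c := c) x₂).cons (x₁, y₁) 0 1 0
    exact hS ▸ thresholdSum_one_le (hl h)
  rw [thresholdSum_two]
  obtain ⟨u, U, hu, huU, hUa, hcase, hn, hle⟩ := exists_dominatingPart_le (c := c)
    (a := 1 - y₁ - y₂) (n := y₁ * x₁ + y₂ * (x₁ + x₂)) (X₂ := x₁ + x₂) hx₁ (by linarith) h1
    hy₁ hy₂ (by ring) rfl (by rw [h2])
  refine hle.trans ?_
  rw [hn] at h2 ⊢
  -- With no outer dominating block, the first isolated block has degree zero and the shape is a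
  -- scaled one. With no inner dominating block, the isolated blocks fuse. With an empty clique, the
  -- shape has two dominating and two isolated blocks.
  rcases hcase with rfl | rfl | rfl
  · refine le_trans (le_of_eq ?_) (cliqueStar_scaled_le (c := c) (p := U) (a := 1 - y₁ - y₂)
      (b := 1 - y₁) huU hUa (by linarith) (by linarith) (by rw [h2]; ring))
    simp only [dominatingPart]
    ring
  · refine le_trans (le_of_eq ?_) (cliqueStar_le_starCliqueBound (c := c) (p := u)
      (a := 1 - y₁ - y₂) hu hUa (by linarith) (by rw [h2]; ring))
    simp only [dominatingPart]
    ring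
  · refine le_trans (le_of_eq ?_) (twoStar_le_starCliqueBound (c := c) (p := u)
      (a := 1 - y₁ - y₂) (b := 1 - y₁) hu huU (by linarith) (by linarith) (by rw [h2]; ring))
    simp only [dominatingPart]
    ring

/-! ### The bound for all threshold shapes -/

theorem thresholdSum_le_starCliqueBound {c : ℝ} (l : List (ℝ × ℝ))
    (h : IsThresholdList c 0 1 0 l) : thresholdSum c 0 1 0 l ≤ starCliqueBound c := by
  induction hn : l.length using Nat.strong_induction_on generalizing l with
  | _ n ih =>
  match l, h with
  | [], h =>
    obtain ⟨_, rfl⟩ := h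
    refine le_trans (le_of_eq ?_) (clique_le_starCliqueBound (by norm_num))
    simp [thresholdSum]
  | [(x, y)], h => exact thresholdSum_one_le h
  | [(x₁, y₁), (x₂, y₂)], h => exact thresholdSum_two_le h
  | (x₁, y₁) :: (x₂, y₂) :: (x₃, y₃) :: l, h =>
    have shorten : ∀ z₁ z₂ z₃, (z₁ = 0 ∨ z₂ = 0 ∨ z₃ = 0 ∨ x₂ = 0 ∨ x₃ = 0) →
        IsThresholdList c 0 1 0 ((x₁, z₁) :: (x₂, z₂) :: (x₃, z₃) :: l) →
        thresholdSum c 0 1 0 ((x₁, z₁) :: (x₂, z₂) :: (x₃, z₃) :: l) ≤ starCliqueBound c := by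
      intro z₁ z₂ z₃ hz hl
      obtain ⟨l', hlen, hm⟩ := exists_mergesTo_of_eq_zero (c := c) l hz
      obtain ⟨h₁, h₂⟩ := hm 0 1 0
      rw [h₂]
      exact ih _ (by rw [← hn]; exact hlen) l' (h₁ hl) rfl
    have h' := h
    rw [isThresholdList_three] at h'
    obtain ⟨hx₁, hy₁, hx₂, hy₂, hx₃, hy₃, hl⟩ := h'
    rcases eq_or_lt_of_le hx₂ with hx₂ | hx₂
    · exact shorten _ _ _ (by tauto) h
    rcases eq_or_lt_of_le hx₃ with hx₃ | hx₃
    · exact shorten _ _ _ (by tauto) h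
    have hV := hl.le
    obtain ⟨z₁, z₂, z₃, hz₁, hz₂, hz₃, hz, hsum, hden, hle⟩ := exists_isolatedPart_le c
      (y₁ * x₁ + y₂ * (x₁ + x₂) + y₃ * (x₁ + x₂ + x₃) +
          (x₁ + x₂ + x₃) * (1 - (y₁ + y₂ + y₃))) hx₁ hx₂ hx₃ hy₁ hy₂ hy₃ (by linarith)
    have hl' : IsThresholdList c 0 1 0 ((x₁, z₁) :: (x₂, z₂) :: (x₃, z₃) :: l) := by
      rw [isThresholdList_three, hsum, hden]
      exact ⟨hx₁, hz₁, hx₂.le, hz₂, hx₃.le, hz₃, hl⟩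
    refine le_trans ?_ (shorten z₁ z₂ z₃ (by tauto) hl')
    rw [thresholdSum_three, thresholdSum_three, hsum, hden]
    gcongr

/-! ### Resolving a fractional cell -/

/-- Splitting one of the two blocks of a partially filled off-diagonal cell does not decrease `S`. -/
lemma le_split_left_or_right {X V M g x y θ : ℝ} (hX : 0 ≤ X) (hx : 0 < x) (hy : 0 < y)
    (hθ : 0 ≤ θ) (hθ1 : θ ≤ 1) (hV : X + x + y ≤ V) (hM : X * V ≤ M)
    (hg : M + x * (V - y + θ * y) + y * (X + θ * x) ≤ g) :
    (θ * x * g ^ 2 + (1 - θ) * x * (g - y * (X + θ * x)) ^ 2 +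
        θ * y * (M + x * (V - y + θ * y)) ^ 2 + (1 - θ) * y * M ^ 2 ≤
      θ * x * g ^ 2 + (1 - θ) * x * (g - y * (X + θ * x)) ^ 2 + y * (M + θ * x * V) ^ 2) ∨
    (θ * x * g ^ 2 + (1 - θ) * x * (g - y * (X + θ * x)) ^ 2 +
        θ * y * (M + x * (V - y + θ * y)) ^ 2 + (1 - θ) * y * M ^ 2 ≤
      x * (g - (1 - θ) * y * X) ^ 2 + θ * y * (M + x * (V - y + θ * y)) ^ 2 +
        (1 - θ) * y * M ^ 2) := by
  obtain ⟨v, rfl⟩ : ∃ v, V = v + y := ⟨V - y, by ring⟩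
  have hv : 0 < v := by linarith
  have hθ' : 0 ≤ 1 - θ := by linarith
  -- The first split gains `θ * (1 - θ) * x * y` times `2 * M * y - x * (v ^ 2 - θ * y ^ 2)`; the
  -- second gains the same factor times `2 * g * x - y * (X ^ 2 + 2 * X * x + θ * x ^ 2)`. If the
  -- first bracket is not positive, `M ≥ X * V` makes `X * y` and `θ * y` small, which forces the
  -- second to be nonnegative.
  rcases le_total (x * (v ^ 2 - θ * y ^ 2)) (2 * M * y) with h | h
  · left
    have : 0 ≤ y * (θ * (1 - θ) * x) * (2 * M * y - x * (v ^ 2 - θ * y ^ 2)) :=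
      mul_nonneg (by positivity) (by linarith)
    linarith
  · right
    have h1 : 2 * X * v * y + 2 * X * y ^ 2 + θ * (x * y ^ 2) ≤ x * v ^ 2 := by
      nlinarith
    have h2 : 2 * X * y ≤ x * v := by
      have : v * (2 * X * y) ≤ v * (x * v) := by
        have : 0 ≤ X * y ^ 2 := by positivity
        have : 0 ≤ θ * (x * y ^ 2) := by positivity
        linarith
      exact le_of_mul_le_mul_left this hv
    have h3 : θ * y ≤ v := by
      have : (θ * y) ^ 2 ≤ v ^ 2 := by
        have h4 : θ * y ^ 2 ≤ v ^ 2 := by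
          have : x * (θ * y ^ 2) ≤ x * v ^ 2 := by
            have : 0 ≤ X * y ^ 2 := by positivity
            have : 0 ≤ X * v * y := by positivity
            linarith
          exact le_of_mul_le_mul_left this hx
        have : θ ^ 2 * y ^ 2 ≤ θ * y ^ 2 := by
          have : θ ^ 2 ≤ θ := by nlinarith
          gcongr
        rw [mul_pow]
        linarith
      exact le_of_sq_le_sq this hv.le
    have hg' : X * (v + y) + x * v + y * X ≤ g := by
      have : 0 ≤ x * (θ * y) := by positivity
      linarith
    have h5 : y * (X ^ 2 + 2 * X * x + θ * x ^ 2) ≤ 2 * g * x := by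
      have e1 : X * (2 * X * y) ≤ X * (x * v) := mul_le_mul_of_nonneg_left h2 hX
      have e2 : x ^ 2 * (θ * y) ≤ x ^ 2 * v := mul_le_mul_of_nonneg_left h3 (sq_nonneg x)
      have e3 : x * (X * (v + y) + x * v + y * X) ≤ x * g := mul_le_mul_of_nonneg_left hg' hx.le
      have e4 : 0 ≤ x * (X * v) := by positivity
      have e5 : 0 ≤ x ^ 2 * v := by positivity
      have e6 : 0 ≤ x * (X * y) := by positivity
      linarith
    have : 0 ≤ x * ((1 - θ) * y * θ) * (2 * g * x - y * (X ^ 2 + 2 * X * x + θ * x ^ 2)) :=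
      mul_nonneg (by positivity) (by linarith)
    linarith

/-- Replacing a partially filled diagonal cell by a clique or a star does not decrease `S`. -/
lemma le_clique_or_star {X M x r σ : ℝ} (hX : 0 ≤ X) (hx : 0 < x) (hr : 0 ≤ r) (hr1 : r ≤ 1)
    (hσ : 0 ≤ σ) (hσ1 : σ ≤ 1) (hσr : 2 * σ - σ ^ 2 = r ^ 2) (hM : X * (X + x) ≤ M) :
    (r ^ 2 * x * (M + x * (X + r ^ 2 * x)) ^ 2 + (1 - r ^ 2) * x * M ^ 2 ≤
      (1 - r) * x * M ^ 2 + r * x * (M + x * (X + r ^ 2 * x) - (1 - r) * x * X) ^ 2) ∨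
    (r ^ 2 * x * (M + x * (X + r ^ 2 * x)) ^ 2 + (1 - r ^ 2) * x * M ^ 2 ≤
      σ * x * (M + x * (X + r ^ 2 * x)) ^ 2 + (1 - σ) * x * (M + σ * x * (X + x)) ^ 2) := by
  -- The clique's gain has the sign of `2 * M * r + r ^ 3 * x ^ 2 - X ^ 2`. If this is not positive,
  -- `M ≥ X ^ 2` forces `r ≤ 1 / 2`, and a cell that sparse favours the star.
  rcases le_total (X ^ 2) (2 * M * r + r ^ 3 * x ^ 2) with h | h
  · left
    have : 0 ≤ r ^ 2 * x ^ 3 * (1 - r) * (2 * M * r + r ^ 3 * x ^ 2 - X ^ 2) :=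
      mul_nonneg (mul_nonneg (by positivity) (by linarith)) (by linarith)
    linarith
  · right
    have hMX : X ^ 2 ≤ M := by
      have : 0 ≤ X * x := by positivity
      linarith
    have hr2 : r ≤ 1 / 2 := by
      by_contra! hlt
      have h1 : 0 < r ^ 3 * x ^ 2 := by positivity
      have h2 : X ^ 2 * r ≤ M * r := mul_le_mul_of_nonneg_right hMX hr
      have h3 : X ^ 2 * (1 / 2) ≤ X ^ 2 * r := mul_le_mul_of_nonneg_left hlt.le (sq_nonneg X)
      linarith
    have hθ : 4 * r ^ 2 ≤ 1 := by nlinarith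
    have h1 : (X + r ^ 2 * x) ^ 2 ≤ 2 * M * (1 - r ^ 2) + σ * (X + x) ^ 2 := by
      have e1 : X * (X + x) * (1 - r ^ 2) ≤ M * (1 - r ^ 2) :=
        mul_le_mul_of_nonneg_right hM (by linarith)
      have e2 : X * (X + x) * (3 / 4) ≤ X * (X + x) * (1 - r ^ 2) :=
        mul_le_mul_of_nonneg_left (by linarith) (by positivity)
      have e3 : r ^ 2 * r ^ 2 ≤ σ := by nlinarith
      have e4 : r ^ 2 * r ^ 2 * x ^ 2 ≤ σ * x ^ 2 := mul_le_mul_of_nonneg_right e3 (sq_nonneg x)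
      have e5 : 0 ≤ σ * (X ^ 2 + 2 * X * x) := by positivity
      have e6 : r ^ 2 * (X * x) ≤ 1 / 4 * (X * x) :=
        mul_le_mul_of_nonneg_right (by linarith) (by positivity)
      have e7 : 0 ≤ X * x := by positivity
      have e8 := sq_nonneg X
      linarith
    have : 0 ≤ σ * (1 - σ) * x ^ 3 *
        (2 * M * (1 - r ^ 2) + σ * (X + x) ^ 2 - (X + r ^ 2 * x) ^ 2) :=
      mul_nonneg (mul_nonneg (mul_nonneg hσ (by linarith)) (by positivity)) (by linarith)
    rw [← hσr] at this ⊢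
    linarith

/-! ### Layer-cake form of the sum -/

section minSum

variable {ι : Type*}

/-- The sum `∑ w_i w_j v_i v_j min(v_i, v_j)` over a finite set of blocks. -/
noncomputable def minSum (s : Finset ι) (w v : ι → ℝ) : ℝ :=
  ∑ i ∈ s, ∑ j ∈ s, w i * w j * (v i * v j * min (v i) (v j))

lemma minSum_insert [DecidableEq ι] {s : Finset ι} {b : ι} (hb : b ∉ s) (w v : ι → ℝ) :
    minSum (insert b s) w v = minSum s w v + w b ^ 2 * v b ^ 3 +
      2 * w b * v b * ∑ i ∈ s, w i * (v i * min (v b) (v i)) := by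
  simp only [minSum, Finset.sum_insert hb, Finset.sum_add_distrib, min_self]
  have h1 : ∑ j ∈ s, w b * w j * (v b * v j * min (v b) (v j)) =
      w b * v b * ∑ i ∈ s, w i * (v i * min (v b) (v i)) := by
    rw [Finset.mul_sum]
    exact Finset.sum_congr rfl fun j _ => by ring
  have h2 : ∑ i ∈ s, w i * w b * (v i * v b * min (v i) (v b)) =
      w b * v b * ∑ i ∈ s, w i * (v i * min (v b) (v i)) := by
    rw [Finset.mul_sum]
    exact Finset.sum_congr rfl fun j _ => by rw [min_comm]; ring
  rw [h1, h2]
  ring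

lemma minSum_insert_min [DecidableEq ι] {s : Finset ι} {b : ι} (hb : b ∉ s) {w v : ι → ℝ}
    (h : ∀ i ∈ s, v b ≤ v i) :
    minSum (insert b s) w v = minSum s w v + w b ^ 2 * v b ^ 3 +
      2 * w b * v b ^ 2 * ∑ i ∈ s, w i * v i := by
  rw [minSum_insert hb, Finset.sum_congr rfl fun i hi => by rw [min_eq_left (h i hi), ← mul_assoc],
    ← Finset.sum_mul]
  ring

lemma minSum_insert_max [DecidableEq ι] {s : Finset ι} {b : ι} (hb : b ∉ s) {w v : ι → ℝ}
    (h : ∀ i ∈ s, v i ≤ v b) :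
    minSum (insert b s) w v = minSum s w v + w b ^ 2 * v b ^ 3 +
      2 * w b * v b * ∑ i ∈ s, w i * v i ^ 2 := by
  rw [minSum_insert hb, Finset.sum_congr rfl fun i hi => by rw [min_eq_right (h i hi), ← sq]]

/-- The integral of `(∑_{v_i > t} w_i v_i)²` over `t` between `X` and `V`, when `v` takes values in
`[X, V]` on `s`, and blocks of total `width * degree` equal to `M` have degree at least `V`. -/
noncomputable def levelSum (X V M : ℝ) (s : Finset ι) (w v : ι → ℝ) : ℝ :=
  minSum s w v + 2 * M * ∑ i ∈ s, w i * v i ^ 2 + V * M ^ 2 - X * (M + ∑ i ∈ s, w i * v i) ^ 2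

lemma levelSum_shift (X V X' V' M : ℝ) (s : Finset ι) (w v : ι → ℝ) :
    levelSum X V M s w v = (V - V') * M ^ 2 + (X' - X) * (M + ∑ i ∈ s, w i * v i) ^ 2 +
      levelSum X' V' M s w v := by
  simp only [levelSum]
  ring

/-- A block whose degree is the top level counts at every level in the interval, so its mass can be
moved into `M`. -/
lemma levelSum_insert_max [DecidableEq ι] {s : Finset ι} {b : ι} (hb : b ∉ s) {w v : ι → ℝ}
    (h : ∀ i ∈ s, v i ≤ v b) (X M : ℝ) :
    levelSum X (v b) M (insert b s) w v = levelSum X (v b) (M + w b * v b) s w v := by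
  simp only [levelSum, minSum_insert_max hb h, Finset.sum_insert hb]
  ring

/-- A block whose degree is the bottom level lies above no level of the interval and contributes
nothing. -/
lemma levelSum_insert_min [DecidableEq ι] {s : Finset ι} {b : ι} (hb : b ∉ s) {w v : ι → ℝ}
    (h : ∀ i ∈ s, v b ≤ v i) (V M : ℝ) :
    levelSum (v b) V M (insert b s) w v = levelSum (v b) V M s w v := by
  simp only [levelSum, minSum_insert_min hb h, Finset.sum_insert hb]
  ring

end minSum

/-! ### Peeling a nested matrix into a threshold list -/

section peeling

variable {ι : Type*}

/-- Induction on the set `s` of remaining blocks. `X` is the width of the dominating blocks already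
removed, `V - X` the width of `s`, and `N` the mass `width * degree` of the removed isolated blocks;
the removed dominating blocks then have mass `X * V + N`. Nestedness makes the cell of the blocks of
largest and smallest degree a minimum of one row and a maximum of the other. -/
lemma exists_isThresholdList_levelSum_le [DecidableEq ι] {c : ℝ} {w v : ι → ℝ} {a : ι → ι → ℝ}
    (hw : ∀ i, 0 < w i) (ha0 : ∀ i j, 0 ≤ a i j) (ha1 : ∀ i j, a i j ≤ 1)
    (hsymm : ∀ i j, a i j = a j i) (hv : Function.Injective v)
    (hmono : ∀ i j k, v k ≤ v i → a k j ≤ a i j)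
    (hfrac : ∀ i j k l, 0 < a i j → a i j < 1 → 0 < a k l → a k l < 1 →
      (i = k ∧ j = l) ∨ (i = l ∧ j = k)) :
    ∀ (n : ℕ) (s : Finset ι), s.card = n → ∀ X V N : ℝ, 0 ≤ X → 0 ≤ N → V = X + ∑ i ∈ s, w i →
      (∀ i ∈ s, v i = X + ∑ j ∈ s, a i j * w j) →
      c = X * V + 2 * N + ∑ i ∈ s, w i * v i →
      ∃ l, IsThresholdList c X V N l ∧ levelSum X V (X * V + N) s w v ≤ thresholdSum c X V N l := by
  intro n
  induction n using Nat.strong_induction_on with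
  | _ n ih =>
  intro s hs X V N hX hN hV hvs hc
  rcases s.eq_empty_or_nonempty with rfl | hne
  · simp only [Finset.sum_empty, add_zero] at hV hc
    subst hV
    refine ⟨[], ⟨le_rfl, by rw [hc]; ring⟩, ?_⟩
    simp [levelSum, minSum, thresholdSum]
  obtain ⟨i, hi, himax⟩ := s.exists_max_image v hne
  obtain ⟨k, hk, hkmin⟩ := s.exists_min_image v hne
  have hXV : X ≤ V := by
    rw [hV]
    linarith [Finset.sum_nonneg fun j (_ : j ∈ s) => (hw j).le]
  have hwnn : ∀ t : Finset ι, 0 ≤ ∑ j ∈ t, w j := fun t => Finset.sum_nonneg fun j _ => (hw j).le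
  have hvnn : ∀ j ∈ s, 0 ≤ v j := fun j hj => by
    rw [hvs j hj]
    exact add_nonneg hX (Finset.sum_nonneg fun m _ => mul_nonneg (ha0 _ _) (hw m).le)
  -- the corner entry decides which block is removed
  rcases eq_or_lt_of_le (ha1 i k) with hcorner | hlt1
  · -- `i` is adjacent to all
    have hall : ∀ j ∈ s, a i j = 1 := fun j hj => by
      refine le_antisymm (ha1 _ _) ?_
      rw [← hcorner, hsymm i k, hsymm i j]
      exact hmono _ _ _ (hkmin j hj)
    have hs' : insert i (s.erase i) = s := Finset.insert_erase hi
    have hvi : v i = V := by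
      rw [hvs i hi, hV, Finset.sum_congr rfl fun j hj => by rw [hall j hj, one_mul]]
    have hsum : ∀ f : ι → ℝ, ∑ j ∈ s, f j = f i + ∑ j ∈ s.erase i, f j := fun f =>
      (Finset.add_sum_erase s f hi).symm
    obtain ⟨l, hl, hle⟩ := ih (s.erase i).card (by
        rw [← hs]; exact Finset.card_erase_lt_of_mem hi) (s.erase i) rfl (X + w i) V N
      (by linarith [hw i]) hN (by rw [hV, hsum]; ring)
      (fun j hj => by
        have hj' := Finset.mem_of_mem_erase hj
        rw [hvs j hj', hsum, hsymm j i, hall j hj']; ring)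
      (by rw [hc, hsum, hvi]; ring)
    refine ⟨(w i, 0) :: l, ⟨(hw i).le, le_rfl, by simpa using hl⟩, ?_⟩
    simp only [thresholdSum, zero_mul, add_zero, sub_zero]
    rw [levelSum_shift X V (X + w i) V]
    have h1 : X * V + N + ∑ j ∈ s, w j * v j = c - N := by rw [hc]; ring
    have h2 : levelSum (X + w i) V (X * V + N) s w v =
        levelSum (X + w i) V ((X + w i) * V + N) (s.erase i) w v := by
      have := levelSum_insert_max (Finset.notMem_erase i s) (w := w) (v := v)
        (fun j hj => himax j (Finset.mem_of_mem_erase hj)) (X + w i) (X * V + N)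
      rw [hs', hvi] at this
      rw [this]
      congr 1
      ring
    rw [h1, h2]
    linarith
  rcases eq_or_lt_of_le (ha0 i k) with hcorner | hgt0
  · -- `k` is isolated
    have hall : ∀ j ∈ s, a k j = 0 := fun j hj => by
      refine le_antisymm ?_ (ha0 _ _)
      rw [hcorner, hsymm k j]
      exact hmono _ _ _ (himax j hj)
    have hs' : insert k (s.erase k) = s := Finset.insert_erase hk
    have hvk : v k = X := by
      rw [hvs k hk, Finset.sum_congr rfl fun j hj => by rw [hall j hj, zero_mul]]
      simp
    have hsum : ∀ f : ι → ℝ, ∑ j ∈ s, f j = f k + ∑ j ∈ s.erase k, f j := fun f =>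
      (Finset.add_sum_erase s f hk).symm
    obtain ⟨l, hl, hle⟩ := ih (s.erase k).card (by
        rw [← hs]; exact Finset.card_erase_lt_of_mem hk) (s.erase k) rfl X (V - w k) (N + w k * X)
      hX (add_nonneg hN (mul_nonneg (hw k).le hX)) (by rw [hV, hsum]; ring)
      (fun j hj => by
        have hj' := Finset.mem_of_mem_erase hj
        rw [hvs j hj', hsum, hsymm j k, hall j hj']; ring)
      (by rw [hc, hsum, hvk]; ring)
    refine ⟨(0, w k) :: l, ⟨le_rfl, (hw k).le, by simpa using hl⟩, ?_⟩
    simp only [thresholdSum, zero_mul, add_zero, zero_add]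
    rw [levelSum_shift X V X (V - w k)]
    have h2 : levelSum X (V - w k) (X * V + N) s w v =
        levelSum X (V - w k) (X * (V - w k) + (N + w k * X)) (s.erase k) w v := by
      have := levelSum_insert_min (Finset.notMem_erase k s) (w := w) (v := v)
        (fun j hj => hkmin j (Finset.mem_of_mem_erase hj)) (V - w k) (X * V + N)
      rw [hs', hvk] at this
      rw [this]
      congr 1
      ring
    rw [h2]
    linarith
  rcases eq_or_ne i k with rfl | hik
  · -- a single block, partially filled
    have hsi : s = {i} := by
      refine Finset.eq_singleton_iff_unique_mem.2 ⟨hi, fun j hj => ?_⟩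
      exact hv (le_antisymm (himax j hj) (hkmin j hj))
    subst hsi
    simp only [Finset.sum_singleton] at hV hc
    have hvi := hvs i hi
    simp only [Finset.sum_singleton] at hvi
    obtain ⟨x, hx⟩ : ∃ x, x = w i := ⟨_, rfl⟩
    have hx0 : 0 < x := hx ▸ hw i
    -- Relative to `x`, a clique of width `r` and a star of centre `1 - t` both have density `a i
    -- i`.
    obtain ⟨r, hr0, hr⟩ : ∃ r, 0 ≤ r ∧ r ^ 2 = a i i := ⟨_, Real.sqrt_nonneg _, Real.sq_sqrt (ha0 i i)⟩
    obtain ⟨t, ht0, ht⟩ : ∃ t, 0 ≤ t ∧ t ^ 2 = 1 - a i i :=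
      ⟨_, Real.sqrt_nonneg _, Real.sq_sqrt (by linarith)⟩
    have hr1 : r ≤ 1 := by nlinarith
    have ht1 : t ≤ 1 := by nlinarith
    have hlevel : levelSum X V (X * V + N) {i} w v =
        r ^ 2 * x * (X * V + N + x * (X + r ^ 2 * x)) ^ 2 + (1 - r ^ 2) * x * (X * V + N) ^ 2 := by
      simp only [levelSum, minSum, Finset.sum_singleton, min_self]
      rw [hvi, hV, hr, hx]
      ring
    rw [hvi, ← hx, ← hr] at hc
    rw [← hx] at hV
    rcases le_clique_or_star (X := X) (M := X * V + N) (x := x) (r := r) (σ := 1 - t) hX hx0 hr0 hr1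
      (by linarith) (by linarith) (by rw [hr]; linarith) (by rw [hV]; linarith) with h | h
    · refine ⟨[(0, (1 - r) * x)], ⟨le_rfl, mul_nonneg (by linarith) hx0.le, ?_, ?_⟩, ?_⟩
      · have : 0 ≤ r * x := by positivity
        rw [hV]; linarith
      · rw [hc, hV]; ring
      · rw [hlevel]
        refine h.trans (le_of_eq ?_)
        simp only [thresholdSum]
        rw [hc, hV]
        ring
    · have hr' : r ^ 2 = 1 - t ^ 2 := by linarith
      refine ⟨[((1 - t) * x, t * x)], ⟨mul_nonneg (by linarith) hx0.le, by positivity, ?_, ?_⟩, ?_⟩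
      · rw [hV]; linarith
      · rw [hc, hV, hr']; ring
      · rw [hlevel]
        refine h.trans (le_of_eq ?_)
        simp only [thresholdSum]
        rw [hc, hV]
        ring
  · -- two blocks with a partially filled common cell
    have hrow : ∀ j ∈ s, j ≠ k → a i j = 1 := fun j hj hjk => by
      by_contra hne1
      have h1 : a i k ≤ a i j := by
        rw [hsymm i k, hsymm i j]; exact hmono _ _ _ (hkmin j hj)
      rcases hfrac i j i k (hgt0.trans_le h1) (lt_of_le_of_ne (ha1 _ _) hne1) hgt0 hlt1 with h | h
      · exact hjk h.2
      · exact hik h.1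
    have hcol : ∀ j ∈ s, j ≠ i → a k j = 0 := fun j hj hji => by
      by_contra hne0
      have h1 : a k j ≤ a k i := by
        rw [hsymm k j, hsymm k i]; exact hmono _ _ _ (himax j hj)
      have h2 : a k j < 1 := by
        refine h1.trans_lt ?_
        rw [hsymm]; exact hlt1
      rcases hfrac k j i k (lt_of_le_of_ne (ha0 _ _) (Ne.symm hne0)) h2 hgt0 hlt1 with h | h
      · exact hik h.1.symm
      · exact hji h.2
    have hki : k ∈ s.erase i := Finset.mem_erase.2 ⟨hik.symm, hk⟩
    obtain ⟨t, ht⟩ : ∃ t, t = (s.erase i).erase k := ⟨_, rfl⟩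
    have hts : ∀ j ∈ t, j ∈ s ∧ j ≠ i ∧ j ≠ k := fun j hj => by
      rw [ht, Finset.mem_erase, Finset.mem_erase] at hj
      exact ⟨hj.2.2, hj.2.1, hj.1⟩
    have hkt : k ∉ t := by rw [ht]; exact Finset.notMem_erase _ _
    have hit : i ∉ insert k t := by
      rw [ht, Finset.insert_erase hki]; exact Finset.notMem_erase _ _
    have hs' : insert i (insert k t) = s := by
      rw [ht, Finset.insert_erase hki, Finset.insert_erase hi]
    have hsum : ∀ f : ι → ℝ, ∑ j ∈ s, f j = f i + (f k + ∑ j ∈ t, f j) := fun f => by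
      rw [← hs', Finset.sum_insert hit, Finset.sum_insert hkt]
    obtain ⟨x, hx⟩ : ∃ x, x = w i := ⟨_, rfl⟩
    obtain ⟨y, hy⟩ : ∃ y, y = w k := ⟨_, rfl⟩
    obtain ⟨θ, hθ⟩ : ∃ θ, θ = a i k := ⟨_, rfl⟩
    have hx0 : 0 < x := hx ▸ hw i
    have hy0 : 0 < y := hy ▸ hw k
    have hVt : V = X + x + y + ∑ j ∈ t, w j := by rw [hV, hsum, ← hx, ← hy]; ring
    have hvi : v i = V - (1 - θ) * y := by
      rw [hvs i hi, hsum, hrow i hi hik, Finset.sum_congr rfl fun j hj => by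
        rw [hrow j (hts j hj).1 (hts j hj).2.2, one_mul], hVt, ← hx, ← hy, ← hθ]
      ring
    have hvk : v k = X + θ * x := by
      rw [hvs k hk, hsum, hcol k hk hik.symm, Finset.sum_congr rfl fun j hj => by
        rw [hcol j (hts j hj).1 (hts j hj).2.1, zero_mul], hsymm k i, ← hx, ← hθ]
      simp
    have hcardt : t.card < n := by
      rw [← hs, ← hs', Finset.card_insert_of_notMem hit, Finset.card_insert_of_notMem hkt]
      omega
    have hdeg_nonneg : 0 ≤ ∑ j ∈ t, w j * v j :=
      Finset.sum_nonneg fun j hj => mul_nonneg (hw j).le (hvnn j (hts j hj).1)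
    have hθ0 : 0 ≤ θ := hθ ▸ ha0 i k
    have hθ1 : θ ≤ 1 := hθ ▸ ha1 i k
    have hVxy : X + x + y ≤ V := by linarith [hwnn t]
    -- Both blocks leave together: the others are fully joined to `i` and not at all to `k`, so
    -- their degrees do not depend on `θ` and either split is compatible with the rest.
    obtain ⟨l, hl, hle⟩ := ih t.card hcardt t rfl (X + x) (V - y) (N + y * (X + θ * x))
      (by linarith) (by positivity) (by rw [hVt]; ring)
      (fun j hj => by
        obtain ⟨hjs, hji, hjk⟩ := hts j hj
        rw [hvs j hjs, hsum, hsymm j i, hrow j hjs hjk, hsymm j k, hcol j hjs hji, ← hx]; ring)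
      (by rw [hc, hsum, hvi, hvk, ← hx, ← hy]; ring)
    have hg : c - N = X * V + N + x * (V - y + θ * y) + y * (X + θ * x) + ∑ j ∈ t, w j * v j := by
      rw [hc, hsum, hvi, hvk, ← hx, ← hy]; ring
    have hlevel : levelSum X V (X * V + N) s w v =
        θ * x * (c - N) ^ 2 + (1 - θ) * x * (c - N - y * (X + θ * x)) ^ 2 +
        θ * y * (X * V + N + x * (V - y + θ * y)) ^ 2 + (1 - θ) * y * (X * V + N) ^ 2 +
        levelSum (X + x) (V - y) ((X + x) * (V - y) + (N + y * (X + θ * x))) t w v := by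
      have h1 := levelSum_insert_max hit (w := w) (v := v) (fun j hj => by
        refine himax j ?_
        rw [← hs']
        exact Finset.mem_insert_of_mem hj) (v k) (X * V + N)
      have h2 := levelSum_insert_min hkt (w := w) (v := v) (fun j hj => hkmin j (hts j hj).1)
        (v i) (X * V + N + w i * v i)
      rw [hs', h2] at h1
      rw [levelSum_shift X V (v k) (v i), h1, levelSum_shift (v k) (v i) (X + x) (V - y)]
      have h3 : X * V + N + ∑ j ∈ s, w j * v j = c - N := by rw [hc]; ring
      have h4 : X * V + N + w i * v i + ∑ j ∈ t, w j * v j = c - N - y * (X + θ * x) := by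
        rw [hg, hvi, ← hx]; ring
      have h5 : X * V + N + w i * v i = (X + x) * (V - y) + (N + y * (X + θ * x)) := by
        rw [hvi, ← hx]; ring
      rw [h3, h4, h5, hvi, hvk]
      ring
    rcases le_split_left_or_right (X := X) (V := V) (M := X * V + N) (g := c - N) (x := x) (y := y)
      (θ := θ) hX hx0 hy0 hθ0 hθ1 hVxy (by linarith) (by linarith) with h | h
    · refine ⟨(θ * x, y) :: ((1 - θ) * x, 0) :: l, ⟨by positivity, hy0.le,
        mul_nonneg (by linarith) hx0.le, le_rfl, ?_⟩, ?_⟩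
      · convert hl using 1 <;> ring
      · simp only [thresholdSum]
        rw [show X + θ * x + (1 - θ) * x = X + x by ring, show V - y - 0 = V - y by ring,
          show N + y * (X + θ * x) + 0 * (X + x) = N + y * (X + θ * x) by ring, hlevel]
        linarith
    · refine ⟨(0, (1 - θ) * y) :: (x, θ * y) :: l, ⟨le_rfl, mul_nonneg (by linarith) hy0.le,
        hx0.le, by positivity, ?_⟩, ?_⟩
      · convert hl using 1 <;> ring
      · simp only [thresholdSum]
        rw [show X + 0 + x = X + x by ring, show V - (1 - θ) * y - θ * y = V - y by ring,
          show N + (1 - θ) * y * (X + 0) + θ * y * (X + x) = N + y * (X + θ * x) by ring, hlevel]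
        linarith

end peeling

/-! ### Strict convexity along order-preserving changes -/

section secondDifference

variable {ι : Type*} [DecidableEq ι]

/-- Adding a block `b` of least degree, with `G` and `Γ` the sums of `w * v` and `w * η` over the
others, raises the second difference by `6 * w b ^ 2 * v b * η b ^ 2 + 8 * w b * v b * η b * Γ + 4 *
w b * η b ^ 2 * G`. The term `4 * u * (∑ w * η) ^ 2` is carried through the induction, used at `u =
v b`, to complete the square with the mixed term. -/
lemma minSum_second_difference {w v η : ι → ℝ} (s : Finset ι) (hw : ∀ i, 0 ≤ w i)
    (hv : ∀ i, 0 ≤ v i)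
    (hord : ∀ i j, v i ≤ v j → v i + η i ≤ v j + η j ∧ v i - η i ≤ v j - η j) :
    ∀ u, 0 ≤ u → (∀ i ∈ s, u ≤ v i) →
      4 * u * (∑ i ∈ s, w i * η i) ^ 2 + 2 * ∑ i ∈ s, w i ^ 2 * v i * η i ^ 2 ≤
        minSum s w (fun i => v i + η i) + minSum s w (fun i => v i - η i) - 2 * minSum s w v := by
  induction s using Finset.induction_on_min_value v with
  | empty => simp [minSum]
  | insert b s hb hmin ih =>
    intro u hu hus
    have hub := hus b (Finset.mem_insert_self _ _)
    have hG : 0 ≤ ∑ i ∈ s, w i * v i := Finset.sum_nonneg fun i _ => mul_nonneg (hw i) (hv i)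
    have h := ih (v b) (hv b) hmin
    rw [minSum_insert_min hb (fun i hi => (hord b i (hmin i hi)).1),
      minSum_insert_min hb (fun i hi => (hord b i (hmin i hi)).2), minSum_insert_min hb hmin,
      Finset.sum_insert hb, Finset.sum_insert hb]
    simp only [mul_add, mul_sub, Finset.sum_add_distrib, Finset.sum_sub_distrib]
    generalize (∑ i ∈ s, w i * v i) = G at *
    generalize (∑ i ∈ s, w i * η i) = Γ at *
    have h1 : u * (w b * η b + Γ) ^ 2 ≤ v b * (w b * η b + Γ) ^ 2 :=
      mul_le_mul_of_nonneg_right hub (sq_nonneg _)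
    have h2 : 0 ≤ w b * η b ^ 2 * G := mul_nonneg (mul_nonneg (hw b) (sq_nonneg _)) hG
    linarith

lemma exists_minSum_lt {w v η : ι → ℝ} [Fintype ι] (hw : ∀ i, 0 < w i)
    (hv : ∀ i, 0 ≤ v i) (hinj : Function.Injective v) (hη : η ≠ 0) (hsum : ∑ i, w i * η i = 0) :
    ∀ᶠ t in nhds (0 : ℝ), t ≠ 0 →
      2 * minSum Finset.univ w v < minSum Finset.univ w (fun i => v i + t * η i) +
        minSum Finset.univ w (fun i => v i - t * η i) := by
  have hord : ∀ᶠ t in nhds (0 : ℝ), ∀ i j, v i ≤ v j →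
      v i + t * η i ≤ v j + t * η j ∧ v i - t * η i ≤ v j - t * η j := by
    rw [Filter.eventually_all]
    intro i
    rw [Filter.eventually_all]
    intro j
    rcases eq_or_ne i j with rfl | hij
    · exact Filter.Eventually.of_forall fun t _ => ⟨le_rfl, le_rfl⟩
    rcases lt_or_ge (v i) (v j) with hlt | hge
    · have h1 : ∀ᶠ t in nhds (0 : ℝ), v i + t * η i < v j + t * η j := by
        refine (ContinuousAt.eventually_lt (by fun_prop) (by fun_prop) ?_)
        simpa using hlt
      have h2 : ∀ᶠ t in nhds (0 : ℝ), v i - t * η i < v j - t * η j := by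
        refine (ContinuousAt.eventually_lt (by fun_prop) (by fun_prop) ?_)
        simpa using hlt
      filter_upwards [h1, h2] with t h1 h2 _
      exact ⟨h1.le, h2.le⟩
    · exact Filter.Eventually.of_forall fun t h => absurd (hinj (le_antisymm h hge)) hij
  filter_upwards [hord] with t ht ht0
  have key := minSum_second_difference (η := fun i => t * η i) Finset.univ (fun i => (hw i).le) hv
    ht 0 le_rfl (fun i _ => hv i)
  have hpos : 0 < ∑ i, w i ^ 2 * v i * (t * η i) ^ 2 := by
    obtain ⟨p, hp⟩ : ∃ p, η p ≠ 0 := Function.ne_iff.1 hη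
    -- The lower bound degenerates at degree zero. At most one block has that degree, and as `∑ w *
    -- η = 0`, `η` cannot be supported on it alone.
    obtain ⟨m, hm, hvm⟩ : ∃ m, η m ≠ 0 ∧ 0 < v m := by
      rcases eq_or_lt_of_le (hv p) with h0 | h0
      · have : ∃ m, m ≠ p ∧ η m ≠ 0 := by
          by_contra! hcon
          rw [Finset.sum_eq_single p (fun b _ hb => by rw [hcon b hb, mul_zero])
            (fun h => absurd (Finset.mem_univ p) h)] at hsum
          exact mul_ne_zero (hw p).ne' hp hsum
        obtain ⟨m, hmp, hm⟩ := this
        refine ⟨m, hm, lt_of_le_of_ne (hv m) fun h => hmp (hinj ?_)⟩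
        rw [← h, h0]
      · exact ⟨p, hp, h0⟩
    refine Finset.sum_pos' (fun i _ => ?_) ⟨m, Finset.mem_univ m, ?_⟩
    · exact mul_nonneg (mul_nonneg (sq_nonneg _) (hv i)) (sq_nonneg _)
    · have := hw m
      have : 0 < (t * η m) ^ 2 := by positivity
      positivity
  linarith

end secondDifference

/-! ### Block matrices and extremal choices by compactness -/

section blocks

variable {ι : Type*}

lemma isCompact_unit_symm : IsCompact {a : ι → ι → ℝ |
    (∀ i j, a i j ∈ Set.Icc (0 : ℝ) 1) ∧ ∀ i j, a i j = a j i} := by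
  have h1 : IsCompact (Set.univ.pi fun _ : ι => Set.univ.pi fun _ : ι => Set.Icc (0 : ℝ) 1) :=
    isCompact_univ_pi fun _ => isCompact_univ_pi fun _ => isCompact_Icc
  have h2 : IsClosed {a : ι → ι → ℝ | ∀ i j, a i j = a j i} := by
    simp only [Set.ofPred_forall]
    exact isClosed_iInter fun i => isClosed_iInter fun j =>
      isClosed_eq (by fun_prop) (by fun_prop)
  convert h1.inter_right h2 using 1
  ext a
  simp only [Set.mem_inter_iff, Set.mem_pi, Set.mem_univ, true_imp_iff]
  rfl

variable [Fintype ι]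

/-- The marginal of a block matrix `a` with block widths `w`. -/
def blockDeg (w : ι → ℝ) (a : ι → ι → ℝ) (i : ι) : ℝ := ∑ j, a i j * w j

lemma blockDeg_add_smul (w : ι → ℝ) (a b : ι → ι → ℝ) (t : ℝ) :
    blockDeg w (fun i j => a i j + t * b i j) = fun i => blockDeg w a i + t * blockDeg w b i := by
  funext i
  simp only [blockDeg, add_mul, Finset.sum_add_distrib, Finset.mul_sum, mul_assoc]

lemma continuous_blockDeg (w : ι → ℝ) (i : ι) :
    Continuous fun a : ι → ι → ℝ => blockDeg w a i := by
  unfold blockDeg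
  fun_prop

lemma exists_max_minSum (w : ι → ℝ) (c : ℝ) {a : ι → ι → ℝ}
    (ha : ∀ i j, a i j ∈ Set.Icc (0 : ℝ) 1) (hsymm : ∀ i j, a i j = a j i)
    (hc : ∑ i, w i * blockDeg w a i = c) :
    ∃ b : ι → ι → ℝ, (∀ i j, b i j ∈ Set.Icc (0 : ℝ) 1) ∧ (∀ i j, b i j = b j i) ∧
      ∑ i, w i * blockDeg w b i = c ∧
      ∀ a : ι → ι → ℝ, (∀ i j, a i j ∈ Set.Icc (0 : ℝ) 1) → (∀ i j, a i j = a j i) →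
        ∑ i, w i * blockDeg w a i = c →
        minSum Finset.univ w (blockDeg w a) ≤ minSum Finset.univ w (blockDeg w b) := by
  have hclosed : IsClosed {a : ι → ι → ℝ | ∑ i, w i * blockDeg w a i = c} :=
    isClosed_eq (continuous_finsetSum _ fun i _ =>
      continuous_const.mul (continuous_blockDeg w i)) continuous_const
  have hcont : Continuous fun a : ι → ι → ℝ => minSum Finset.univ w (blockDeg w a) := by
    unfold minSum
    have := continuous_blockDeg w
    fun_prop
  obtain ⟨b, ⟨⟨hb1, hb2⟩, hb3⟩, hmax⟩ := (isCompact_unit_symm.inter_right hclosed).exists_isMaxOn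
    ⟨a, ⟨ha, hsymm⟩, hc⟩ hcont.continuousOn
  exact ⟨b, hb1, hb2, hb3, fun a h1 h2 h3 => hmax ⟨⟨h1, h2⟩, h3⟩⟩

/-- A tie-break among matrices with the same degrees, hence the same `S`: the least square norm will
force nestedness. -/
lemma exists_min_sq (w : ι → ℝ) {a : ι → ι → ℝ}
    (ha : ∀ i j, a i j ∈ Set.Icc (0 : ℝ) 1) (hsymm : ∀ i j, a i j = a j i) :
    ∃ b : ι → ι → ℝ, (∀ i j, b i j ∈ Set.Icc (0 : ℝ) 1) ∧ (∀ i j, b i j = b j i) ∧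
      blockDeg w b = blockDeg w a ∧
      ∀ a : ι → ι → ℝ, (∀ i j, a i j ∈ Set.Icc (0 : ℝ) 1) → (∀ i j, a i j = a j i) →
        blockDeg w a = blockDeg w b →
        ∑ i, ∑ j, w i * w j * b i j ^ 2 ≤ ∑ i, ∑ j, w i * w j * a i j ^ 2 := by
  have hclosed : IsClosed {b : ι → ι → ℝ | blockDeg w b = blockDeg w a} :=
    isClosed_eq (continuous_pi fun i => continuous_blockDeg w i) continuous_const
  have hcont : Continuous fun a : ι → ι → ℝ => ∑ i, ∑ j, w i * w j * a i j ^ 2 := by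
    fun_prop
  obtain ⟨b, ⟨⟨hb1, hb2⟩, hb3⟩, hmin⟩ := (isCompact_unit_symm.inter_right hclosed).exists_isMinOn
    ⟨a, ⟨ha, hsymm⟩, rfl⟩ hcont.continuousOn
  exact ⟨b, hb1, hb2, hb3, fun a h1 h2 h3 => hmin ⟨⟨h1, h2⟩, h3.trans hb3⟩⟩

end blocks

/-! ### Perturbing an extremal matrix -/

section perturbation

variable {ι : Type*} [DecidableEq ι]

lemma eventually_perturb_mem_Icc {x d : ℝ} (hx : x ∈ Set.Icc (0 : ℝ) 1) (h1 : 0 < d → x < 1)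
    (h0 : d < 0 → 0 < x) :
    ∀ᶠ t in nhdsWithin (0 : ℝ) (Set.Ioi 0), x + t * d ∈ Set.Icc (0 : ℝ) 1 := by
  rcases lt_trichotomy d 0 with hd | rfl | hd
  · have : ∀ᶠ t in nhds (0 : ℝ), 0 < x + t * d := by
      refine ContinuousAt.eventually_lt (by fun_prop) (by fun_prop) ?_
      simpa using h0 hd
    filter_upwards [this.filter_mono nhdsWithin_le_nhds, self_mem_nhdsWithin] with t ht ht0
    exact ⟨ht.le, by nlinarith [hx.2, mul_neg_of_pos_of_neg (Set.mem_Ioi.1 ht0) hd]⟩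
  · simpa using hx
  · have : ∀ᶠ t in nhds (0 : ℝ), x + t * d < 1 := by
      refine ContinuousAt.eventually_lt (by fun_prop) (by fun_prop) ?_
      simpa using h1 hd
    filter_upwards [this.filter_mono nhdsWithin_le_nhds, self_mem_nhdsWithin] with t ht ht0
    exact ⟨by nlinarith [hx.1, mul_pos (Set.mem_Ioi.1 ht0) hd], ht.le⟩

/-- The signed indicator of `i` against `k`, normalised by the widths. -/
noncomputable def transfer (w : ι → ℝ) (i k p : ι) : ℝ :=
  (if p = i then 1 / w i else 0) - (if p = k then 1 / w k else 0)

lemma eq_of_transfer_pos {w : ι → ℝ} (hw : ∀ i, 0 < w i) {i k p : ι}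
    (h : 0 < transfer w i k p) : p = i := by
  by_contra hp
  rw [transfer, if_neg hp] at h
  split_ifs at h
  · linarith [one_div_pos.2 (hw k)]
  · linarith

lemma eq_of_transfer_neg {w : ι → ℝ} (hw : ∀ i, 0 < w i) {i k p : ι}
    (h : transfer w i k p < 0) : p = k := by
  by_contra hp
  rw [transfer, if_neg hp] at h
  split_ifs at h
  · linarith [one_div_pos.2 (hw i)]
  · linarith

/-- The symmetric indicator of the cells `(i, j)` and `(j, i)`, normalised by the widths. -/
noncomputable def symmCell (w : ι → ℝ) (i j p q : ι) : ℝ :=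
  ((if p = i then 1 else 0) * (if q = j then 1 else 0) +
    (if p = j then 1 else 0) * (if q = i then 1 else 0)) / (w p * w q)

lemma symmCell_comm (w : ι → ℝ) (i j p q : ι) : symmCell w i j p q = symmCell w i j q p := by
  rw [symmCell, symmCell, mul_comm (w p)]
  congr 1
  ring

lemma symmCell_ne_zero {w : ι → ℝ} {i j p q : ι} (h : symmCell w i j p q ≠ 0) :
    (p = i ∧ q = j) ∨ (p = j ∧ q = i) := by
  by_contra hcon
  push Not at hcon
  refine h ?_
  rw [symmCell]
  have h1 : (if p = i then (1 : ℝ) else 0) * (if q = j then 1 else 0) = 0 := by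
    by_cases hp : p = i
    · simp [hcon.1 hp]
    · simp [hp]
  have h2 : (if p = j then (1 : ℝ) else 0) * (if q = i then 1 else 0) = 0 := by
    by_cases hp : p = j
    · simp [hcon.2 hp]
    · simp [hp]
  rw [h1, h2]
  simp

lemma eq_or_eq_swap_of_indicator {i j k l : ι}
    (h : ∀ p, (if p = i then (1 : ℝ) else 0) + (if p = j then 1 else 0) =
      (if p = k then 1 else 0) + (if p = l then 1 else 0)) :
    (i = k ∧ j = l) ∨ (i = l ∧ j = k) := by
  by_cases h1 : i = k
  · subst h1
    refine Or.inl ⟨rfl, ?_⟩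
    by_contra hjl
    have := h j
    simp only [if_neg hjl, if_true] at this
    linarith
  by_cases h2 : i = l
  · subst h2
    refine Or.inr ⟨rfl, ?_⟩
    by_contra hjk
    have := h j
    simp only [if_neg hjk, if_true] at this
    linarith
  have := h i
  simp only [if_neg h1, if_neg h2, if_true] at this
  split_ifs at this <;> linarith

variable [Fintype ι]

lemma sum_transfer {w : ι → ℝ} (hw : ∀ i, 0 < w i) (i k : ι) (f : ι → ℝ) :
    ∑ p, transfer w i k p * (w p * f p) = f i - f k := by
  simp only [transfer, sub_mul, Finset.sum_sub_distrib, ite_mul, zero_mul, Finset.sum_ite_eq',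
    Finset.mem_univ, if_true]
  have := (hw i).ne'
  have := (hw k).ne'
  field_simp

/-- If `a k j > a i j` although `k` has no larger degree than `i`, some `j'` satisfies `a k j' < a i
j'`. Shifting mass from `(k, j)` and `(i, j')` to `(i, j)` and `(k, j')`, symmetrically, keeps every
degree and lowers the square norm to first order. -/
lemma monotone_of_min_sq {w : ι → ℝ} (hw : ∀ i, 0 < w i) {a : ι → ι → ℝ}
    (ha : ∀ i j, a i j ∈ Set.Icc (0 : ℝ) 1) (hsymm : ∀ i j, a i j = a j i)
    (hmin : ∀ b : ι → ι → ℝ, (∀ i j, b i j ∈ Set.Icc (0 : ℝ) 1) → (∀ i j, b i j = b j i) →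
        blockDeg w b = blockDeg w a →
        ∑ i, ∑ j, w i * w j * a i j ^ 2 ≤ ∑ i, ∑ j, w i * w j * b i j ^ 2)
    (i j k : ι) (hki : blockDeg w a k ≤ blockDeg w a i) : a k j ≤ a i j := by
  by_contra! hlt
  obtain ⟨j', hj'⟩ : ∃ j', a k j' < a i j' := by
    by_contra! hcon
    have : blockDeg w a i < blockDeg w a k :=
      Finset.sum_lt_sum (fun m _ => mul_le_mul_of_nonneg_right (hcon m) (hw m).le)
        ⟨j, Finset.mem_univ j, mul_lt_mul_of_pos_right hlt (hw j)⟩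
    linarith
  set α := transfer w i k with hα
  set β := transfer w j j' with hβ
  -- Symmetrised products of transfers handle coincidences among `i`, `k`, `j`, `j'` without
  -- separate cases.
  obtain ⟨B, hB⟩ : ∃ B : ι → ι → ℝ, ∀ p q, B p q = α p * β q + β p * α q := ⟨_, fun _ _ => rfl⟩
  have hBdeg : ∀ p, blockDeg w B p = 0 := by
    intro p
    have h1 := sum_transfer hw i k (fun _ => 1)
    have h2 := sum_transfer hw j j' (fun _ => 1)
    simp only [mul_one, sub_self, ← hα, ← hβ] at h1 h2
    have : blockDeg w B p = α p * ∑ q, β q * w q + β p * ∑ q, α q * w q := by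
      simp only [blockDeg, hB, Finset.mul_sum, ← Finset.sum_add_distrib]
      exact Finset.sum_congr rfl fun q _ => by ring
    rw [this, h1, h2]
    ring
  -- signs of the products
  have hprod_pos : ∀ p q, 0 < α p * β q → a p q < 1 := by
    intro p q h
    rcases pos_and_pos_or_neg_and_neg_of_mul_pos h with ⟨h1, h2⟩ | ⟨h1, h2⟩
    · rw [eq_of_transfer_pos hw h1, eq_of_transfer_pos hw h2]
      exact hlt.trans_le (ha _ _).2
    · rw [eq_of_transfer_neg hw h1, eq_of_transfer_neg hw h2]
      exact hj'.trans_le (ha _ _).2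
  have hprod_neg : ∀ p q, α p * β q < 0 → 0 < a p q := by
    intro p q h
    rcases mul_neg_iff.1 h with ⟨h1, h2⟩ | ⟨h1, h2⟩
    · rw [eq_of_transfer_pos hw h1, eq_of_transfer_neg hw h2]
      exact (ha _ _).1.trans_lt hj'
    · rw [eq_of_transfer_neg hw h1, eq_of_transfer_pos hw h2]
      exact (ha _ _).1.trans_lt hlt
  have hmem : ∀ᶠ t in nhdsWithin (0 : ℝ) (Set.Ioi 0), ∀ p q,
      a p q + t * B p q ∈ Set.Icc (0 : ℝ) 1 := by
    rw [Filter.eventually_all]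
    intro p
    rw [Filter.eventually_all]
    intro q
    refine eventually_perturb_mem_Icc (ha p q) (fun h => ?_) (fun h => ?_)
    · rw [hB] at h
      rcases lt_or_ge 0 (α p * β q) with h1 | h1
      · exact hprod_pos p q h1
      · rw [hsymm]
        exact hprod_pos q p (by linarith)
    · rw [hB] at h
      rcases lt_or_ge (α p * β q) 0 with h1 | h1
      · exact hprod_neg p q h1
      · rw [hsymm]
        exact hprod_neg q p (by linarith)
  obtain ⟨P, hP⟩ : ∃ P, P = ∑ p, ∑ q, w p * w q * (a p q * B p q) := ⟨_, rfl⟩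
  obtain ⟨Q, hQ⟩ : ∃ Q, Q = ∑ p, ∑ q, w p * w q * B p q ^ 2 := ⟨_, rfl⟩
  have hPneg : P < 0 := by
    have h1 : ∑ p, ∑ q, w p * w q * (a p q * (α p * β q)) =
        (a i j - a i j') - (a k j - a k j') := by
      have : ∀ p, ∑ q, w p * w q * (a p q * (α p * β q)) = α p * (w p * (a p j - a p j')) := by
        intro p
        rw [← sum_transfer hw j j' (fun q => a p q), Finset.mul_sum, Finset.mul_sum]
        exact Finset.sum_congr rfl fun q _ => by ring
      rw [Finset.sum_congr rfl fun p _ => this p, sum_transfer hw i k (fun p => a p j - a p j')]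
    have h2 : ∑ p, ∑ q, w p * w q * (a p q * (β p * α q)) =
        ∑ p, ∑ q, w p * w q * (a p q * (α p * β q)) := by
      rw [Finset.sum_comm]
      exact Finset.sum_congr rfl fun p _ => Finset.sum_congr rfl fun q _ => by
        rw [hsymm q p]; ring
    have h3 : P = ∑ p, ∑ q, w p * w q * (a p q * (α p * β q)) +
        ∑ p, ∑ q, w p * w q * (a p q * (β p * α q)) := by
      rw [hP, ← Finset.sum_add_distrib]
      refine Finset.sum_congr rfl fun p _ => ?_
      rw [← Finset.sum_add_distrib]
      exact Finset.sum_congr rfl fun q _ => by rw [hB]; ring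
    rw [h3, h2, h1]
    linarith
  have hdesc : ∀ᶠ t in nhds (0 : ℝ), 2 * P + t * Q < 0 := by
    refine ContinuousAt.eventually_lt (by fun_prop) (by fun_prop) ?_
    linarith
  obtain ⟨t, ⟨ht1, ht2⟩, ht0⟩ := ((hmem.and (hdesc.filter_mono nhdsWithin_le_nhds)).and
    self_mem_nhdsWithin).exists
  have ht0 : 0 < t := ht0
  have := hmin (fun p q => a p q + t * B p q) ht1
    (fun p q => by rw [hsymm p q, hB, hB]; ring)
    (by rw [blockDeg_add_smul]; funext p; rw [hBdeg]; ring)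
  have hexp : ∑ p, ∑ q, w p * w q * (a p q + t * B p q) ^ 2 =
      ∑ p, ∑ q, w p * w q * a p q ^ 2 + t * (2 * P + t * Q) := by
    have : t * (2 * P + t * Q) = 2 * t * P + t ^ 2 * Q := by ring
    rw [this, hP, hQ]
    simp only [Finset.mul_sum, ← Finset.sum_add_distrib]
    exact Finset.sum_congr rfl fun p _ => Finset.sum_congr rfl fun q _ => by ring
  rw [hexp] at this
  have := mul_neg_of_pos_of_neg ht0 ht2
  linarith

lemma width_mul_blockDeg_symmCell {w : ι → ℝ} (hw : ∀ i, 0 < w i) (i j p : ι) :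
    w p * blockDeg w (symmCell w i j) p =
      (if p = i then 1 else 0) + (if p = j then 1 else 0) := by
  have : ∀ q, w p * (symmCell w i j p q * w q) =
      (if p = i then 1 else 0) * (if q = j then 1 else 0) +
        (if p = j then 1 else 0) * (if q = i then 1 else 0) := by
    intro q
    have := (hw p).ne'
    have := (hw q).ne'
    rw [symmCell]
    field_simp
  rw [blockDeg, Finset.mul_sum, Finset.sum_congr rfl fun q _ => this q, Finset.sum_add_distrib,
    ← Finset.mul_sum, ← Finset.mul_sum]
  simp

/-- Mass can be exchanged between two fractional cells in both directions. Distinct unordered pairs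
give different degree vectors, so the degrees really change, and strict convexity makes one
direction increase `S`. -/
lemma fractional_unique_of_max {w : ι → ℝ} (hw : ∀ i, 0 < w i) {a : ι → ι → ℝ} {c : ℝ}
    (ha : ∀ i j, a i j ∈ Set.Icc (0 : ℝ) 1) (hsymm : ∀ i j, a i j = a j i)
    (hc : ∑ i, w i * blockDeg w a i = c) (hinj : Function.Injective (blockDeg w a))
    (hmax : ∀ b : ι → ι → ℝ, (∀ i j, b i j ∈ Set.Icc (0 : ℝ) 1) → (∀ i j, b i j = b j i) →
      ∑ i, w i * blockDeg w b i = c →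
      minSum Finset.univ w (blockDeg w b) ≤ minSum Finset.univ w (blockDeg w a))
    (i j k l : ι) (hij0 : 0 < a i j) (hij1 : a i j < 1) (hkl0 : 0 < a k l) (hkl1 : a k l < 1) :
    (i = k ∧ j = l) ∨ (i = l ∧ j = k) := by
  by_contra hne
  obtain ⟨B, hB⟩ : ∃ B : ι → ι → ℝ, ∀ p q, B p q = symmCell w i j p q - symmCell w k l p q :=
    ⟨_, fun _ _ => rfl⟩
  obtain ⟨η, hη⟩ : ∃ η, η = blockDeg w B := ⟨_, rfl⟩
  have hwη : ∀ p, w p * η p = ((if p = i then 1 else 0) + (if p = j then 1 else 0)) -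
      ((if p = k then 1 else 0) + (if p = l then 1 else 0)) := by
    intro p
    rw [hη, ← width_mul_blockDeg_symmCell hw, ← width_mul_blockDeg_symmCell hw]
    simp only [blockDeg, hB, sub_mul, Finset.sum_sub_distrib, mul_sub]
  have hη0 : η ≠ 0 := by
    rintro rfl
    refine hne (eq_or_eq_swap_of_indicator fun p => ?_)
    have := hwη p
    simp only [Pi.zero_apply, mul_zero] at this
    linarith
  have hsum : ∑ p, w p * η p = 0 := by
    rw [Finset.sum_congr rfl fun p _ => hwη p]
    simp [Finset.sum_sub_distrib, Finset.sum_add_distrib]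
  have hdeg : ∀ p, 0 ≤ blockDeg w a p := fun p =>
    Finset.sum_nonneg fun q _ => mul_nonneg (ha p q).1 (hw q).le
  have hmem : ∀ᶠ t in nhds (0 : ℝ), ∀ p q, a p q + t * B p q ∈ Set.Icc (0 : ℝ) 1 ∧
      a p q + (-t) * B p q ∈ Set.Icc (0 : ℝ) 1 := by
    rw [Filter.eventually_all]
    intro p
    rw [Filter.eventually_all]
    intro q
    by_cases hBpq : B p q = 0
    · simp only [hBpq, mul_zero, add_zero]
      exact Filter.Eventually.of_forall fun _ => ⟨ha p q, ha p q⟩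
    · have hfr : 0 < a p q ∧ a p q < 1 := by
        have : symmCell w i j p q ≠ 0 ∨ symmCell w k l p q ≠ 0 := by
          by_contra! h
          exact hBpq (by rw [hB, h.1, h.2, sub_zero])
        rcases this with h | h
        · rcases symmCell_ne_zero h with ⟨rfl, rfl⟩ | ⟨rfl, rfl⟩
          · exact ⟨hij0, hij1⟩
          · rw [hsymm]; exact ⟨hij0, hij1⟩
        · rcases symmCell_ne_zero h with ⟨rfl, rfl⟩ | ⟨rfl, rfl⟩
          · exact ⟨hkl0, hkl1⟩
          · rw [hsymm]; exact ⟨hkl0, hkl1⟩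
      have h1 : ∀ᶠ t in nhds (0 : ℝ), a p q + t * B p q ∈ Set.Icc (0 : ℝ) 1 := by
        refine ContinuousAt.eventually_mem (by fun_prop) ?_
        simpa using Icc_mem_nhds hfr.1 hfr.2
      have h2 : ∀ᶠ t in nhds (0 : ℝ), a p q + (-t) * B p q ∈ Set.Icc (0 : ℝ) 1 := by
        refine ContinuousAt.eventually_mem (by fun_prop) ?_
        simpa using Icc_mem_nhds hfr.1 hfr.2
      exact h1.and h2
  have hlt := exists_minSum_lt hw hdeg hinj hη0 hsum
  obtain ⟨t, ⟨ht1, ht2⟩, ht0⟩ := (((hmem.and hlt).filter_mono nhdsWithin_le_nhds).and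
    (self_mem_nhdsWithin (a := (0 : ℝ)) (s := Set.Ioi 0))).exists
  have ht0 : 0 < t := ht0
  have hle : ∀ r, (∀ p q, a p q + r * B p q ∈ Set.Icc (0 : ℝ) 1) →
      minSum Finset.univ w (fun p => blockDeg w a p + r * η p) ≤
        minSum Finset.univ w (blockDeg w a) := by
    intro r hr
    rw [hη, ← blockDeg_add_smul]
    refine hmax _ hr (fun p q => ?_) ?_
    · rw [hsymm p q, hB, hB, symmCell_comm w i j, symmCell_comm w k l]
    · rw [blockDeg_add_smul, ← hη]
      simp only [mul_add, Finset.sum_add_distrib]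
      rw [hc, show ∑ p, w p * (r * η p) = r * ∑ p, w p * η p by
        rw [Finset.mul_sum]; exact Finset.sum_congr rfl fun p _ => by ring, hsum]
      ring
  have h1 := hle t (fun p q => (ht1 p q).1)
  have h2 := hle (-t) (fun p q => (ht1 p q).2)
  have h3 := ht2 ht0.ne'
  simp only [neg_mul, ← sub_eq_add_neg] at h2
  linarith

end perturbation

/-! ### Merging blocks of equal degree -/

section quotient

variable {ι : Type} [Fintype ι]

/-- Averaging a block matrix over the fibres of a map under which equal blocks have equal degrees. -/
lemma exists_average {κ : Type} [Fintype κ] [DecidableEq κ] {π : ι → κ}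
    (hsurj : Function.Surjective π) {w : ι → ℝ} (hw : ∀ i, 0 < w i)
    {a : ι → ι → ℝ} (ha : ∀ i j, a i j ∈ Set.Icc (0 : ℝ) 1) (hsymm : ∀ i j, a i j = a j i)
    {v : κ → ℝ} (hπ : ∀ i, v (π i) = blockDeg w a i) :
    ∃ (w' : κ → ℝ) (a' : κ → κ → ℝ), (∀ k, 0 < w' k) ∧
      (∀ i j, a' i j ∈ Set.Icc (0 : ℝ) 1) ∧ (∀ i j, a' i j = a' j i) ∧
      ∑ k, w' k = ∑ i, w i ∧
      ∑ k, w' k * blockDeg w' a' k = ∑ i, w i * blockDeg w a i ∧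
      minSum Finset.univ w' (blockDeg w' a') = minSum Finset.univ w (blockDeg w a) := by
  obtain ⟨w', hw'⟩ : ∃ w' : κ → ℝ, ∀ k, w' k = ∑ i with π i = k, w i := ⟨_, fun _ => rfl⟩
  obtain ⟨m, hm⟩ : ∃ m : κ → κ → ℝ, ∀ k l, m k l =
    ∑ i with π i = k, ∑ j with π j = l, w i * w j * a i j := ⟨_, fun _ _ => rfl⟩
  have hw'0 : ∀ k, 0 < w' k := by
    intro k
    obtain ⟨i, hi⟩ := hsurj k
    rw [hw']
    exact Finset.sum_pos (fun i _ => hw i)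
      ⟨i, Finset.mem_filter.2 ⟨Finset.mem_univ i, hi⟩⟩
  have hm0 : ∀ k l, 0 ≤ m k l := fun k l => by
    rw [hm]
    exact Finset.sum_nonneg fun i _ => Finset.sum_nonneg fun j _ =>
      mul_nonneg (mul_nonneg (hw i).le (hw j).le) (ha i j).1
  have hm1 : ∀ k l, m k l ≤ w' k * w' l := fun k l => by
    rw [hm, hw', hw', Finset.sum_mul_sum]
    exact Finset.sum_le_sum fun i _ => Finset.sum_le_sum fun j _ =>
      mul_le_of_le_one_right (mul_nonneg (hw i).le (hw j).le) (ha i j).2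
  have hmsymm : ∀ k l, m k l = m l k := fun k l => by
    rw [hm, hm, Finset.sum_comm]
    exact Finset.sum_congr rfl fun i _ => Finset.sum_congr rfl fun j _ => by
      rw [hsymm]; ring
  have hfiber : ∀ F : κ → ℝ, ∑ k, w' k * F k = ∑ i, w i * F (π i) := fun F => by
    rw [← Finset.sum_fiberwise Finset.univ π]
    refine Finset.sum_congr rfl fun k _ => ?_
    rw [hw', Finset.sum_mul]
    exact Finset.sum_congr rfl fun i hi => by rw [(Finset.mem_filter.1 hi).2]
  obtain ⟨a', ha'⟩ : ∃ a' : κ → κ → ℝ, ∀ k l, a' k l = m k l / (w' k * w' l) :=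
    ⟨_, fun _ _ => rfl⟩
  have hdeg : ∀ k, blockDeg w' a' k = v k := by
    intro k
    have h1 : ∀ l, a' k l * w' l = m k l / w' k := fun l => by
      have := (hw'0 l).ne'
      have := (hw'0 k).ne'
      rw [ha']
      field_simp
    rw [blockDeg, Finset.sum_congr rfl fun l _ => h1 l, ← Finset.sum_div,
      div_eq_iff (hw'0 k).ne']
    simp only [hm]
    rw [Finset.sum_comm]
    have h2 : ∀ i, ∑ l, ∑ j with π j = l, w i * w j * a i j = w i * v (π i) := fun i => by
      rw [Finset.sum_fiberwise Finset.univ π fun j => w i * w j * a i j, hπ, blockDeg,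
        Finset.mul_sum]
      exact Finset.sum_congr rfl fun j _ => by ring
    rw [Finset.sum_congr rfl fun i _ => h2 i, hw', Finset.mul_sum]
    refine Finset.sum_congr rfl fun i hi => ?_
    rw [(Finset.mem_filter.1 hi).2, mul_comm]
  refine ⟨w', a', hw'0, fun k l => ?_, fun k l => ?_, ?_, ?_, ?_⟩
  · rw [ha']
    exact ⟨div_nonneg (hm0 k l) (mul_pos (hw'0 k) (hw'0 l)).le,
      (div_le_one (mul_pos (hw'0 k) (hw'0 l))).2 (hm1 k l)⟩
  · rw [ha', ha', hmsymm, mul_comm (w' k)]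
  · simpa using hfiber fun _ => 1
  · simp only [hdeg, ← hπ]
    exact hfiber v
  · simp only [minSum, hdeg, ← hπ]
    have h1 : ∀ k : κ, ∑ l : κ, w' k * w' l * (v k * v l * min (v k) (v l)) =
        w' k * ∑ j, w j * (v k * v (π j) * min (v k) (v (π j))) := fun k => by
      rw [← hfiber fun l => v k * v l * min (v k) (v l), Finset.mul_sum]
      exact Finset.sum_congr rfl fun l _ => by ring
    rw [Finset.sum_congr rfl fun k _ => h1 k,
      hfiber fun k => ∑ j, w j * (v k * v (π j) * min (v k) (v (π j)))]
    refine Finset.sum_congr rfl fun i _ => ?_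
    rw [Finset.mul_sum]
    exact Finset.sum_congr rfl fun j _ => by ring

end quotient

/-! ### The bound for block matrices -/

theorem minSum_blockDeg_le (n : ℕ) : ∀ (ι : Type) [Fintype ι], Fintype.card ι = n →
    ∀ (w : ι → ℝ) (a : ι → ι → ℝ) (c : ℝ), (∀ i, 0 < w i) → ∑ i, w i = 1 →
      (∀ i j, a i j ∈ Set.Icc (0 : ℝ) 1) → (∀ i j, a i j = a j i) →
      ∑ i, w i * blockDeg w a i = c →
      minSum Finset.univ w (blockDeg w a) ≤ starCliqueBound c := by
  induction n using Nat.strong_induction_on with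
  | _ n ih =>
  intro ι _ hn w a c hw hw1 ha hsymm hc
  classical
  obtain ⟨b, hb, hbsymm, hbc, hmax⟩ := exists_max_minSum w c ha hsymm hc
  refine (hmax a ha hsymm hc).trans ?_
  by_cases hinj : Function.Injective (blockDeg w b)
  · obtain ⟨d, hd, hdsymm, hdeg, hmin⟩ := exists_min_sq w hb hbsymm
    -- `S` and the density depend on the degrees only, so `d` inherits the maximality of `b`.
    rw [← hdeg] at hinj hbc hmax ⊢
    have hmono := monotone_of_min_sq hw hd hdsymm hmin
    have hfrac := fractional_unique_of_max hw hd hdsymm hbc hinj hmax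
    obtain ⟨l, hl, hle⟩ := exists_isThresholdList_levelSum_le (c := c) hw (fun i j => (hd i j).1)
      (fun i j => (hd i j).2) hdsymm hinj (fun i j k h => hmono i j k h) hfrac _ Finset.univ rfl
      0 1 0 le_rfl le_rfl (by rw [hw1]; ring) (fun i _ => by rw [blockDeg]; ring)
      (by rw [hbc]; ring)
    refine le_trans (le_of_eq ?_) (hle.trans (thresholdSum_le_starCliqueBound l hl))
    simp [levelSum]
  · obtain ⟨w', a', hw', ha', ha'symm, hsum, hdens, hS⟩ := exists_average
      (κ := {x : ℝ // x ∈ Finset.univ.image (blockDeg w b)})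
      (π := fun i => ⟨blockDeg w b i, Finset.mem_image_of_mem _ (Finset.mem_univ i)⟩)
      (v := Subtype.val) (fun ⟨x, hx⟩ => by
        obtain ⟨i, -, hi⟩ := Finset.mem_image.1 hx
        exact ⟨i, Subtype.ext hi⟩) hw hb hbsymm (fun _ => rfl)
    rw [← hS]
    refine ih _ ?_ _ rfl w' a' c hw' (hsum.trans hw1) ha' ha'symm (hdens.trans hbc)
    rw [Fintype.card_coe, ← hn]
    refine lt_of_le_of_ne Finset.card_image_le fun h => hinj ?_
    exact fun i j hij => Finset.card_image_iff.1 h (Finset.mem_coe.2 (Finset.mem_univ i))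
      (Finset.mem_coe.2 (Finset.mem_univ j)) hij

/-! ### From integrals of step functions to block sums -/

section stepFunctions

variable {K : ℕ} {q : Fin (K + 1) → ℝ}

lemma Ico_eq_iUnion_of_monotone (hq : Monotone q) :
    Set.Ico (q 0) (q (Fin.last K)) = ⋃ i : Fin K, Set.Ico (q i.castSucc) (q i.succ) := by
  induction K with
  | zero => simp
  | succ K ih =>
    have h := ih (q := fun i => q i.castSucc) fun i j hij => hq (Fin.castSucc_le_castSucc_iff.2 hij)
    rw [← Set.Ico_union_Ico_eq_Ico (hq (Fin.zero_le (Fin.last K).castSucc))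
      (hq (Fin.le_last _))]
    ext x
    simp only [Set.mem_union, Set.mem_iUnion, Fin.exists_fin_succ']
    have hx := Set.ext_iff.1 h x
    simp only [Set.mem_iUnion, Fin.castSucc_zero] at hx
    rw [hx]
    simp

/-- Monotone rather than strictly monotone grids are allowed because the natural grids of `A₁ c` and
`A₂ c` degenerate at `c = 0` and `c = 1`. -/
lemma setIntegral_step (hq : Monotone q) (h0 : q 0 = 0) (h1 : q (Fin.last K) = 1) {f : ℝ → ℝ}
    {v : Fin K → ℝ} (hf : ∀ i, ∀ x ∈ Set.Ico (q i.castSucc) (q i.succ), f x = v i) :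
    ∫ x in Set.Ico (0 : ℝ) 1, f x = ∑ i : Fin K, (q i.succ - q i.castSucc) * v i := by
  rw [← h0, ← h1, Ico_eq_iUnion_of_monotone hq]
  rw [integral_iUnion_fintype]
  · refine Finset.sum_congr rfl fun i _ => ?_
    rw [setIntegral_congr_fun measurableSet_Ico (hf i), setIntegral_const]
    simp [Measure.real, ENNReal.toReal_ofReal (sub_nonneg.2 (hq i.castSucc_le_succ))]
  · exact fun i => measurableSet_Ico
  · have key : ∀ i j : Fin K, i < j →
        Disjoint (Set.Ico (q i.castSucc) (q i.succ)) (Set.Ico (q j.castSucc) (q j.succ)) :=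
      fun i j hij => Set.disjoint_left.2 fun x hx hx' =>
        (hx.2.trans_le ((hq (Fin.succ_le_castSucc_iff.2 hij)).trans hx'.1)).false
    intro i j hij
    rcases lt_or_gt_of_ne hij with h | h
    · exact key i j h
    · exact (key j i h).symm
  · intro i
    exact (integrableOn_congr_fun (hf i) measurableSet_Ico).2 (integrableOn_const (by simp))

/-- On a grid given by a monotone sequence, `S` is a sum over pairs of blocks. -/
lemma S_eq_minSum (hq : Monotone q) (h0 : q 0 = 0) (h1 : q (Fin.last K) = 1)
    {A : ℝ → ℝ → ℝ} {a : Fin K → Fin K → ℝ}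
    (hA : ∀ i j, ∀ x ∈ Set.Ico (q i.castSucc) (q i.succ),
      ∀ y ∈ Set.Ico (q j.castSucc) (q j.succ), A x y = a i j) :
    S A = minSum Finset.univ (fun i : Fin K => q i.succ - q i.castSucc)
      (blockDeg (fun i : Fin K => q i.succ - q i.castSucc) a) := by
  have hell : ∀ i, ∀ x ∈ Set.Ico (q i.castSucc) (q i.succ),
      ell A x = blockDeg (fun i : Fin K => q i.succ - q i.castSucc) a i := fun i x hx => by
    rw [ell, setIntegral_step hq h0 h1 fun j y hy => hA i j x hx y hy, blockDeg]
    exact Finset.sum_congr rfl fun j _ => mul_comm _ _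
  generalize blockDeg (fun i : Fin K => q i.succ - q i.castSucc) a = d at hell ⊢
  rw [S, setIntegral_step hq h0 h1 (v := fun i => ∑ j : Fin K, (q j.succ - q j.castSucc) *
    (d i * d j * min (d i) (d j))) fun i x hx => ?_, minSum]
  · refine Finset.sum_congr rfl fun i _ => ?_
    rw [Finset.mul_sum]
    exact Finset.sum_congr rfl fun j _ => by ring
  · exact setIntegral_step hq h0 h1 fun j y hy => by rw [hell i x hx, hell j y hy]

end stepFunctions

/-! ### Values at the quasi-star and the quasi-clique -/

lemma monotone_triple {s : ℝ} (hs0 : 0 ≤ s) (hs1 : s ≤ 1) :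
    Monotone (![0, s, 1] : Fin (2 + 1) → ℝ) := by
  rw [Fin.monotone_iff_le_succ]
  intro i
  fin_cases i
  · simpa using hs0
  · simpa using hs1

lemma S_A₁ {c : ℝ} (hc0 : 0 ≤ c) (hc1 : c ≤ 1) :
    S (A₁ c) = (1 - √(1 - c)) ^ 2 * ((c + 1) * √(1 - c) + c) := by
  obtain ⟨r, hr⟩ : ∃ r, r = √(1 - c) := ⟨_, rfl⟩
  have hr2 : r ^ 2 = 1 - c := by rw [hr]; exact Real.sq_sqrt (by linarith)
  have hr0 : 0 ≤ r := by rw [hr]; exact Real.sqrt_nonneg _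
  have hr1 : r ≤ 1 := by nlinarith
  have hA := S_eq_minSum (K := 2) (A := A₁ c) (a := ![![1, 1], ![1, 0]])
    (monotone_triple (s := 1 - r) (by linarith) (by linarith)) rfl rfl (by
      intro i j x hx y hy
      rw [A₁, ← hr]
      fin_cases i <;> fin_cases j <;> simp at hx hy ⊢
      · intro _; linarith [hx.2]
      · intro _; linarith [hx.2]
      · intro _; linarith [hy.2]
      · constructor <;> linarith [hx.1, hy.1])
  have hcr : c = 1 - r ^ 2 := by linarith
  rw [hA, ← hr]
  simp [minSum, blockDeg, Fin.sum_univ_two]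
  have hm1 : min 1 (1 - r) = 1 - r := min_eq_right (by linarith)
  have hm2 : min (1 - r) 1 = 1 - r := min_eq_left (by linarith)
  simp only [hm1, hm2]
  rw [hcr]
  ring

lemma S_A₂ {c : ℝ} (hc0 : 0 ≤ c) (hc1 : c ≤ 1) : S (A₂ c) = c ^ (5 / 2 : ℝ) := by
  obtain ⟨r, hr⟩ : ∃ r, r = √c := ⟨_, rfl⟩
  have hr2 : r ^ 2 = c := by rw [hr]; exact Real.sq_sqrt hc0
  have hr0 : 0 ≤ r := by rw [hr]; exact Real.sqrt_nonneg _
  have hr1 : r ≤ 1 := by nlinarith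
  have hA := S_eq_minSum (K := 2) (A := A₂ c) (a := ![![1, 0], ![0, 0]])
    (monotone_triple (s := r) hr0 hr1) rfl rfl (by
      intro i j x hx y hy
      rw [A₂, ← hr]
      fin_cases i <;> fin_cases j <;> simp at hx hy ⊢
      · exact ⟨hx.2, hy.2⟩
      · exact fun _ => hy.1
      · exact fun h => absurd h (not_lt.2 hx.1)
      · exact fun _ => hy.1)
  rw [hA, rpow_five_halves hc0, ← hr, ← hr2]
  simp [minSum, blockDeg, Fin.sum_univ_two]
  ring

/-! ### The theorem for step functions -/

theorem theorem2 (c : ℝ) (hc0 : 0 ≤ c) (hc1 : c ≤ 1) (K : ℕ) (hK : 0 < K)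
    (A : ℝ → ℝ → ℝ)
    (hrange : ∀ x ∈ Set.Ico (0 : ℝ) 1, ∀ y ∈ Set.Ico (0 : ℝ) 1, A x y ∈ Set.Icc (0 : ℝ) 1)
    (hsymm : ∀ x ∈ Set.Ico (0 : ℝ) 1, ∀ y ∈ Set.Ico (0 : ℝ) 1, A x y = A y x)
    (hint : (∫ y in Set.Ico (0 : ℝ) 1, (∫ x in Set.Ico (0 : ℝ) 1, A x y)) = c)
    (hstep : IsStepOnGrid K A) :
    S A ≤ max (S (A₁ c)) (S (A₂ c)) ∧
      max (S (A₁ c)) (S (A₂ c)) =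
        max ((1 - √(1 - c)) ^ 2 * ((c + 1) * √(1 - c) + c)) (c ^ (5 / 2 : ℝ)) := by
  rw [S_A₁ hc0 hc1, S_A₂ hc0 hc1]
  refine ⟨?_, rfl⟩
  obtain ⟨q, hq, h0, h1, hcell⟩ := hstep
  choose a ha using hcell
  have hmem : ∀ i : Fin K, q i.castSucc ∈ Set.Ico (q i.castSucc) (q i.succ) := fun i =>
    ⟨le_rfl, hq i.castSucc_lt_succ⟩
  have hmem' : ∀ i : Fin K, q i.castSucc ∈ Set.Ico (0 : ℝ) 1 := fun i =>
    ⟨h0 ▸ hq.monotone (Fin.zero_le _), h1 ▸ hq (Fin.castSucc_lt_last i)⟩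
  have haA : ∀ i j, a i j = A (q i.castSucc) (q j.castSucc) := fun i j =>
    (ha i j _ (hmem i) _ (hmem j)).symm
  have ha_mem : ∀ i j, a i j ∈ Set.Icc (0 : ℝ) 1 := fun i j => by
    rw [haA]
    exact hrange _ (hmem' i) _ (hmem' j)
  have ha_symm : ∀ i j, a i j = a j i := fun i j => by
    rw [haA, haA]
    exact hsymm _ (hmem' i) _ (hmem' j)
  rw [S_eq_minSum hq.monotone h0 h1 ha]
  refine minSum_blockDeg_le _ (Fin K) rfl _ a c
    (fun i => sub_pos.2 (hq i.castSucc_lt_succ)) ?_ ha_mem ha_symm ?_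
  · have := setIntegral_step hq.monotone h0 h1 (f := fun _ => 1) (v := fun _ => 1)
      fun _ _ _ => rfl
    simpa using this.symm
  -- The inner integral of `hint` runs over the first variable, so it gives column sums; symmetry of
  -- `a` turns them into degrees.
  · rw [← hint, setIntegral_step hq.monotone h0 h1 fun j y hy =>
      setIntegral_step hq.monotone h0 h1 fun i x hx => ha i j x hx y hy]
    refine Finset.sum_congr rfl fun j _ => ?_
    rw [blockDeg]
    congr 1
    exact Finset.sum_congr rfl fun i _ => by rw [ha_symm i j, mul_comm]
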